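/- Let $K$ be a field and $S=K[x_1,\ldots,x_n]$. A squarefree Borel ideal is an ideal $I\subseteq S$ generated by squarefree monomials such that for each squarefree monomial $u\in I$, each $x_j\mid u$ and each $i<j$, the monomial $x_i(u/x_j)$ belongs to $I$ whenever it is squarefree. For squarefree monomials $w_1,\ldots,w_r$ let $B_1(w_1,\ldots,w_r)$ be the smallest squarefree Borel ideal containing them (the zero ideal if $r=0$). For a monomial ideal $J$ with minimal multigraded free resolution $\cdots\to F_1\to F_0\to J\to 0$, $F_i=\bigoplus_{j}S(-\mathbf a_{ij})$, let $\mathrm{HS}_i(J)$ be the ideal generated by the monomials $\mathbf x^{\mathbf a_{ij}}$. A gap of a squarefree monomial $u$ is an index $i$ with $x_i\nmid u$ such that $i<j$ for some $x_j\mid u$. Let $u_1,\ldots,u_m$ be squarefree monomials of the same degree and let $I=B_1(u_1,\ldots,u_m)$. Then: 1. $\mathrm{HS}_1(I)=B_1\bigl(x_{p_t}u_t : 1\le t\le m,\ u_t \text{ has a gap}\bigr)$, where $p_t$ is the largest gap of $u_t$. 2. For every $k\ge 1$, $\mathrm{HS}_k(I)=B_1\bigl(x_{p_{t1}}\cdots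 x_{p_{tk}}u_t : 1\le t\le m,\ u_t\text{ has at least } k \text{ gaps}\bigr)$, where $p_{t1},\ldots,p_{tk}$ are the $k$ largest gaps of $u_t$. 3. For every $k\ge 1$, $\mathrm{HS}_1(\mathrm{HS}_k(I))=\mathrm{HS}_{k+1}(I)$. -/

import Mathlib

/-! Monomials of `S = K[x_1, …, x_n]` are represented by their exponent vectors
`u : Fin n →₀ ℕ`; the monomial itself is `MvPolynomial.monomial u 1`. The variable `x_1` is
the one with index `0 : Fin n`, and so on, so `x_1 < x_2 < …` is the order of the indices. -/

/-- The ideal of `K[x_1, …, x_n]` generated by the monomials with exponent vectors in `A`. -/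
noncomputable def monomialIdeal (K : Type*) [Field K] {n : ℕ} (A : Set (Fin n →₀ ℕ)) :
    Ideal (MvPolynomial (Fin n) K) :=
  Ideal.span ((fun a => MvPolynomial.monomial a (1 : K)) '' A)

/-- A monomial is `k`-bounded if all its exponents are at most `k`;
`1`-bounded means squarefree. -/
def IsBoundedMonomial (k : ℕ) {n : ℕ} (u : Fin n →₀ ℕ) : Prop :=
  ∀ i, u i ≤ k

/-- `k`-Borel ideals: ideals generated by `k`-bounded monomials such that for each `k`-bounded
monomial `u ∈ I`, each `j ∈ supp u` and each `i < j`, the monomial `x_i (u / x_j)` lies in `I`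
provided it is `k`-bounded. The `1`-Borel ideals are the squarefree Borel ideals. -/
structure IsKBorel {K : Type*} [Field K] {n : ℕ} (k : ℕ)
    (I : Ideal (MvPolynomial (Fin n) K)) : Prop where
  bounded : ∃ A : Set (Fin n →₀ ℕ), (∀ a ∈ A, IsBoundedMonomial k a) ∧ I = monomialIdeal K A
  exchange : ∀ u : Fin n →₀ ℕ, IsBoundedMonomial k u → MvPolynomial.monomial u (1 : K) ∈ I →
    ∀ j ∈ u.support, ∀ i < j,
      IsBoundedMonomial k (u - Finsupp.single j 1 + Finsupp.single i 1) →
        MvPolynomial.monomial (u - Finsupp.single j 1 + Finsupp.single i 1) (1 : K) ∈ I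

/-- `B_k(U)`: the intersection of all `k`-Borel ideals that contain the monomials in `U`. -/
noncomputable def borelIdeal (K : Type*) [Field K] {n : ℕ} (k : ℕ) (U : Set (Fin n →₀ ℕ)) :
    Ideal (MvPolynomial (Fin n) K) :=
  sInf {I | IsKBorel k I ∧ ∀ u ∈ U, MvPolynomial.monomial u (1 : K) ∈ I}

theorem monomial_mem_monomialIdeal {K : Type*} [Field K] {n : ℕ} {A : Set (Fin n →₀ ℕ)}
    {u : Fin n →₀ ℕ} :
    MvPolynomial.monomial u (1 : K) ∈ monomialIdeal K A ↔ ∃ a ∈ A, a ≤ u := by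
  classical
  rw [monomialIdeal, MvPolynomial.mem_ideal_span_monomial_image]
  simp [MvPolynomial.support_monomial]

/-- `B_k(U)` is the smallest `k`-Borel ideal that contains `U`. -/
theorem isLeast_borelIdeal (K : Type*) [Field K] {n : ℕ} (k : ℕ) (U : Set (Fin n →₀ ℕ)) :
    IsLeast {I | IsKBorel k I ∧ ∀ u ∈ U, MvPolynomial.monomial u (1 : K) ∈ I}
      (borelIdeal K k U) := by
  refine ⟨⟨⟨⟨{a | IsBoundedMonomial k a ∧ MvPolynomial.monomial a (1 : K) ∈ borelIdeal K k U},
    fun a ha => ha.1, le_antisymm ?_ ?_⟩, ?_⟩, ?_⟩, fun I hI => sInf_le hI⟩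
  · intro f hf
    rw [monomialIdeal, MvPolynomial.mem_ideal_span_monomial_image]
    intro v hv
    refine ⟨v.mapRange (fun e => min e k) (by simp), ⟨fun i => by simp, ?_⟩,
      fun i => by simp⟩
    rw [borelIdeal, Submodule.mem_sInf] at hf ⊢
    intro I hI
    have hfI := hf I hI
    obtain ⟨B, hB, rfl⟩ := hI.1.bounded
    rw [monomialIdeal, MvPolynomial.mem_ideal_span_monomial_image] at hfI
    obtain ⟨b, hbB, hb⟩ := hfI v hv
    exact monomial_mem_monomialIdeal.2 ⟨b, hbB, fun i => by simpa using ⟨hb i, hB b hbB i⟩⟩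
  · rw [monomialIdeal, Ideal.span_le]
    rintro _ ⟨a, ha, rfl⟩
    exact ha.2
  · intro u hu huI j hj i hij hb
    rw [borelIdeal, Submodule.mem_sInf] at huI ⊢
    exact fun I hI => hI.1.exchange u hu (huI I hI) j hj i hij hb
  · intro u hu
    rw [borelIdeal, Submodule.mem_sInf]
    exact fun I hI => hI.2 u hu

/-- A minimal multigraded free resolution
`⋯ ⟶ F_2 ⟶ F_1 ⟶ F_0 ⟶ I ⟶ 0` of an ideal `I` of `S = K[x_1, …, x_n]`.
The module `F_i = ⨁_j S(-a_{ij})` is free with basis `e_{i1}, …, e_{ib_i}`, where `e_{ij}` has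
multidegree `a_{ij}`, that is, `shift i j`. -/
structure MinimalMultigradedResolution {K : Type*} [Field K] {n : ℕ}
    (I : Ideal (MvPolynomial (Fin n) K)) where
  /-- the ranks of the free modules -/
  b : ℕ → ℕ
  /-- the multigraded shifts -/
  shift : (i : ℕ) → Fin (b i) → (Fin n →₀ ℕ)
  /-- the differential `F_{i+1} ⟶ F_i` -/
  d : (i : ℕ) →
    (Fin (b (i + 1)) → MvPolynomial (Fin n) K) →ₗ[MvPolynomial (Fin n) K]
      (Fin (b i) → MvPolynomial (Fin n) K)
  /-- the augmentation `F_0 ⟶ S`, whose image is `I` -/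
  aug : (Fin (b 0) → MvPolynomial (Fin n) K) →ₗ[MvPolynomial (Fin n) K] MvPolynomial (Fin n) K
  /-- The augmentation is homogeneous of degree `0`: each term of the image of `e_{0j}` has
  multidegree `a_{0j}`. -/
  aug_homogeneous : ∀ j, ∀ c ∈ (aug (Pi.single j 1)).support, c = shift 0 j
  /-- The differentials are homogeneous of degree `0`: each term of the coefficient of `e_{il}`
  in the image of `e_{i+1,j}` has multidegree `a_{i+1,j} - a_{il}`. -/
  d_homogeneous : ∀ i j l, ∀ c ∈ (d i (Pi.single j 1) l).support,
    c + shift i l = shift (i + 1) j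
  range_aug : LinearMap.range aug = I
  exact_zero : LinearMap.range (d 0) = LinearMap.ker aug
  exact_succ : ∀ i, LinearMap.range (d (i + 1)) = LinearMap.ker (d i)
  /-- Minimality: the entries of the matrices of the differentials lie in `(x_1, …, x_n)`. -/
  minimal : ∀ i j l, MvPolynomial.constantCoeff (d i (Pi.single j 1) l) = 0

/-- The `i`-th homological shift ideal `HS_i(I)` of a monomial ideal `I`: it is generated by the
monomials `x^a`, where `a` runs over the multigraded shifts in homological degree `i` of the
minimal multigraded free resolution of `I`. (That resolution exists and is unique up to
isomorphism, so all resolutions as below have the same shifts in each homological degree.) -/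
noncomputable def HS {K : Type*} [Field K] {n : ℕ} (i : ℕ) (I : Ideal (MvPolynomial (Fin n) K)) :
    Ideal (MvPolynomial (Fin n) K) :=
  monomialIdeal K {a | ∃ (F : MinimalMultigradedResolution I) (j : Fin (F.b i)), F.shift i j = a}

/-- The set of gaps of a monomial `u`: the indices `i < max(u)` such that `x_i` does not
divide `u`. -/
def gaps {n : ℕ} (u : Fin n →₀ ℕ) : Set (Fin n) :=
  {i | i ∉ u.support ∧ ∃ j ∈ u.support, i < j}

/-- `P` consists of the `k` largest gaps of `u` (so `u` has at least `k` gaps). -/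
structure IsLargestGaps {n : ℕ} (u : Fin n →₀ ℕ) (k : ℕ) (P : Finset (Fin n)) : Prop where
  subset : ∀ p ∈ P, p ∈ gaps u
  card : P.card = k
  largest : ∀ q ∈ gaps u, q ∉ P → ∀ p ∈ P, q < p

open MvPolynomial

/-- A vector of polynomials is homogeneous of multidegree `a` with respect to the multidegrees
`s` of the basis vectors if each term `x^e` of its `l`-th entry satisfies `e + s l = a`. -/
def IsHomogeneousVec {K : Type*} [Field K] {n : ℕ} {κ : Type*} (s : κ → (Fin n →₀ ℕ))
    (a : Fin n →₀ ℕ) (v : κ → MvPolynomial (Fin n) K) : Prop :=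
  ∀ l, ∀ e ∈ (v l).support, e + s l = a

/-- The part of multidegree `a` of a coefficient of a basis vector of multidegree `t`. -/
noncomputable def homPart {K : Type*} [Field K] {n : ℕ} (a t : Fin n →₀ ℕ) :
    MvPolynomial (Fin n) K →ₗ[K] MvPolynomial (Fin n) K :=
  open Classical in if t ≤ a then (monomial (a - t)).comp (lcoeff K (a - t)) else 0

section Homogeneous

variable {K : Type*} [Field K] {n : ℕ}

theorem homPart_of_le {a t : Fin n →₀ ℕ} (h : t ≤ a) (p : MvPolynomial (Fin n) K) :
    homPart a t p = monomial (a - t) (coeff (a - t) p) := by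
  simp [homPart, h]

theorem homPart_of_not_le {a t : Fin n →₀ ℕ} (h : ¬ t ≤ a) (p : MvPolynomial (Fin n) K) :
    homPart a t p = 0 := by
  simp [homPart, h]

theorem add_eq_of_mem_support_homPart {a t e : Fin n →₀ ℕ} {p : MvPolynomial (Fin n) K}
    (he : e ∈ (homPart a t p).support) : e + t = a := by
  classical
  by_cases h : t ≤ a
  · rw [homPart_of_le h] at he
    rw [Finset.mem_singleton.1 (support_monomial_subset he), tsub_add_cancel_of_le h]
  · simp [homPart_of_not_le h] at he

theorem eq_monomial_of_forall_support {s t : Fin n →₀ ℕ} {q : MvPolynomial (Fin n) K}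
    (hq : ∀ e ∈ q.support, e + s = t) : q = 0 ∨ ∃ e r, e + s = t ∧ q = monomial e r := by
  classical
  by_cases h : q = 0
  · exact Or.inl h
  · obtain ⟨e, he⟩ := Finset.nonempty_of_ne_empty (mt support_eq_empty.1 h)
    refine Or.inr ⟨e, coeff e q, hq e he, ?_⟩
    ext e'
    rw [coeff_monomial]
    split_ifs with hee
    · rw [hee]
    · by_contra hne
      exact hee (add_right_cancel ((hq e he).trans (hq e' (mem_support_iff.2 hne)).symm))

theorem homPart_eq_self {a t : Fin n →₀ ℕ} {p : MvPolynomial (Fin n) K}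
    (hp : ∀ e ∈ p.support, e + t = a) : homPart a t p = p := by
  classical
  obtain rfl | ⟨e, r, rfl, rfl⟩ := eq_monomial_of_forall_support hp
  · simp
  · rw [homPart_of_le le_add_self]
    simp

theorem homPart_mul {a s t : Fin n →₀ ℕ} {q : MvPolynomial (Fin n) K}
    (hq : ∀ e ∈ q.support, e + s = t) (p : MvPolynomial (Fin n) K) :
    homPart a s (p * q) = homPart a t p * q := by
  classical
  obtain rfl | ⟨e, r, rfl, rfl⟩ := eq_monomial_of_forall_support hq
  · simp
  · by_cases h : s ≤ a
    · rw [homPart_of_le h, coeff_mul_monomial']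
      by_cases he : e ≤ a - s
      · have hes : e + s ≤ a := by
          rw [← tsub_add_cancel_of_le h]; exact add_le_add_left he s
        rw [if_pos he, homPart_of_le hes, monomial_mul, tsub_tsub, add_comm s e, ← tsub_tsub,
          tsub_right_comm, tsub_add_cancel_of_le he]
      · have hes : ¬ e + s ≤ a := fun h' => he (le_tsub_of_add_le_right h')
        rw [if_neg he, homPart_of_not_le hes]
        simp
    · have hes : ¬ e + s ≤ a := fun h' => h (le_add_self.trans h')
      rw [homPart_of_not_le h, homPart_of_not_le hes, zero_mul]

theorem IsHomogeneousVec.sum_homPart_smul {ι κ : Type*} [Fintype ι] {s : κ → (Fin n →₀ ℕ)}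
    {sh : ι → (Fin n →₀ ℕ)} {g : ι → κ → MvPolynomial (Fin n) K}
    (hg : ∀ t, IsHomogeneousVec s (sh t) (g t)) {a : Fin n →₀ ℕ}
    {v : κ → MvPolynomial (Fin n) K} (hv : IsHomogeneousVec s a v)
    {w : ι → MvPolynomial (Fin n) K} (h : ∑ t, w t • g t = v) :
    ∑ t, homPart a (sh t) (w t) • g t = v := by
  funext l
  have hl : ∑ t, w t * g t l = v l := by simpa using congrFun h l
  calc (∑ t, homPart a (sh t) (w t) • g t) l = ∑ t, homPart a (s l) (w t * g t l) := by
        simp only [Finset.sum_apply, Pi.smul_apply, smul_eq_mul]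
        exact Finset.sum_congr rfl fun t _ => (homPart_mul (hg t l) _).symm
    _ = v l := by rw [← map_sum, hl, homPart_eq_self (hv l)]

theorem LinearMap.apply_eq_sum_single {R ι M : Type*} [CommSemiring R] [Fintype ι] [DecidableEq ι]
    [AddCommMonoid M] [Module R M] (D : (ι → R) →ₗ[R] M) (v : ι → R) :
    D v = ∑ t, v t • D (Pi.single t 1) := by
  conv_lhs => rw [← LinearMap.sum_single_apply (fun _ : ι => R) v]
  rw [map_sum]
  refine Finset.sum_congr rfl fun t _ => ?_
  rw [← map_smul, ← Pi.single_smul, smul_eq_mul, mul_one]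

theorem exists_isHomogeneousVec_preimage {ι κ : Type*} [Fintype ι] [DecidableEq ι]
    {s : κ → (Fin n →₀ ℕ)} {sh : ι → (Fin n →₀ ℕ)}
    {D : (ι → MvPolynomial (Fin n) K) →ₗ[MvPolynomial (Fin n) K] (κ → MvPolynomial (Fin n) K)}
    (hD : ∀ t, IsHomogeneousVec s (sh t) (D (Pi.single t 1))) {a : Fin n →₀ ℕ}
    {v : κ → MvPolynomial (Fin n) K} (hv : IsHomogeneousVec s a v) (hr : v ∈ LinearMap.range D) :
    ∃ w, IsHomogeneousVec sh a w ∧ D w = v := by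
  obtain ⟨w, hw⟩ := hr
  refine ⟨fun t => homPart a (sh t) (w t), fun l e he => add_eq_of_mem_support_homPart he, ?_⟩
  rw [LinearMap.apply_eq_sum_single] at hw ⊢
  exact IsHomogeneousVec.sum_homPart_smul hD hv hw

theorem IsHomogeneousVec.map {ι κ : Type*} [Fintype ι] [DecidableEq ι]
    {s : κ → (Fin n →₀ ℕ)} {sh : ι → (Fin n →₀ ℕ)}
    {D : (ι → MvPolynomial (Fin n) K) →ₗ[MvPolynomial (Fin n) K] (κ → MvPolynomial (Fin n) K)}
    (hD : ∀ t, IsHomogeneousVec s (sh t) (D (Pi.single t 1))) {a : Fin n →₀ ℕ}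
    {v : ι → MvPolynomial (Fin n) K} (hv : IsHomogeneousVec sh a v) :
    IsHomogeneousVec s a (D v) := by
  classical
  intro l e he
  rw [LinearMap.apply_eq_sum_single, Finset.sum_apply] at he
  obtain ⟨t, -, ht⟩ := Finset.mem_biUnion.1 (support_sum he)
  obtain ⟨e₁, h₁, e₂, h₂, rfl⟩ := Finset.mem_add.1 (support_mul _ _ ht)
  rw [add_assoc, hD t l e₂ h₂, hv t e₁ h₁]

/-- A homogeneous lift of a homogeneous map along a homogeneous map. -/
theorem exists_homogeneous_lift {ι κ μ : Type*} [Fintype ι] [DecidableEq ι] [Fintype μ]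
    [DecidableEq μ] {s : κ → (Fin n →₀ ℕ)} {sh : ι → (Fin n →₀ ℕ)} {sh' : μ → (Fin n →₀ ℕ)}
    {D : (ι → MvPolynomial (Fin n) K) →ₗ[MvPolynomial (Fin n) K] (κ → MvPolynomial (Fin n) K)}
    (hD : ∀ t, IsHomogeneousVec s (sh t) (D (Pi.single t 1)))
    {E : (μ → MvPolynomial (Fin n) K) →ₗ[MvPolynomial (Fin n) K] (κ → MvPolynomial (Fin n) K)}
    (hE : ∀ t, IsHomogeneousVec s (sh' t) (E (Pi.single t 1)))
    (hr : LinearMap.range E ≤ LinearMap.range D) :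
    ∃ φ : (μ → MvPolynomial (Fin n) K) →ₗ[MvPolynomial (Fin n) K] (ι → MvPolynomial (Fin n) K),
      (∀ t, IsHomogeneousVec sh (sh' t) (φ (Pi.single t 1))) ∧ D ∘ₗ φ = E := by
  choose w hw hDw using fun t => exists_isHomogeneousVec_preimage hD (hE t) (hr ⟨_, rfl⟩)
  have hφ : ∀ t, Fintype.linearCombination (MvPolynomial (Fin n) K) w (Pi.single t 1) = w t := by
    intro t
    rw [Fintype.linearCombination_apply_single, one_smul]
  refine ⟨Fintype.linearCombination _ w, fun t => (hφ t).symm ▸ hw t, ?_⟩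
  refine LinearMap.pi_ext' fun t => LinearMap.ext_ring ?_
  simp [hφ, hDw]

theorem constantCoeff_linearMap_apply {ι κ : Type*} [Fintype ι] [DecidableEq ι]
    (D : (ι → MvPolynomial (Fin n) K) →ₗ[MvPolynomial (Fin n) K] (κ → MvPolynomial (Fin n) K))
    (v : ι → MvPolynomial (Fin n) K) (l : κ)
    (h : ∀ t, constantCoeff (v t) = 0 ∨ constantCoeff (D (Pi.single t 1) l) = 0) :
    constantCoeff (D v l) = 0 := by
  rw [LinearMap.apply_eq_sum_single, Finset.sum_apply, map_sum]
  refine Finset.sum_eq_zero fun t _ => ?_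
  rcases h t with h | h <;> simp [h]

end Homogeneous

theorem exists_dependent_seq {α : ℕ → Type*} {P : ∀ i, α i → Prop}
    {r : ∀ i, α i → α (i + 1) → Prop} (h0 : ∃ x, P 0 x)
    (hs : ∀ i x, P i x → ∃ y, P (i + 1) y ∧ r i x y) :
    ∃ f : ∀ i, α i, P 0 (f 0) ∧ ∀ i, P (i + 1) (f (i + 1)) ∧ r i (f i) (f (i + 1)) := by
  obtain ⟨x, hx⟩ := h0
  choose y hy hr using hs
  let f : ∀ i, {x : α i // P i x} :=
    fun i => Nat.rec ⟨x, hx⟩ (fun i z => ⟨y i z.1 z.2, hy i z.1 z.2⟩) i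
  exact ⟨fun i => (f i).1, hx, fun i => ⟨(f (i + 1)).2, hr i (f i).1 (f i).2⟩⟩

namespace MinimalMultigradedResolution

variable {K : Type*} [Field K] {n : ℕ} {I : Ideal (MvPolynomial (Fin n) K)}

theorem exists_comparison (F G : MinimalMultigradedResolution I) :
    ∃ φ : ∀ i, (Fin (G.b i) → MvPolynomial (Fin n) K) →ₗ[MvPolynomial (Fin n) K]
        (Fin (F.b i) → MvPolynomial (Fin n) K),
      F.aug ∘ₗ φ 0 = G.aug ∧ (∀ i, F.d i ∘ₗ φ (i + 1) = φ i ∘ₗ G.d i) ∧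
        ∀ i j, IsHomogeneousVec (F.shift i) (G.shift i j) (φ i (Pi.single j 1)) := by
  have h0 : ∃ φ : (Fin (G.b 0) → MvPolynomial (Fin n) K) →ₗ[MvPolynomial (Fin n) K]
      (Fin (F.b 0) → MvPolynomial (Fin n) K), F.aug ∘ₗ φ = G.aug ∧
      ∀ j, IsHomogeneousVec (F.shift 0) (G.shift 0 j) (φ (Pi.single j 1)) := by
    obtain ⟨φ, hφ, hc⟩ := exists_homogeneous_lift (s := fun _ : Unit => 0) (sh := F.shift 0)
      (sh' := G.shift 0) (D := LinearMap.pi fun _ => F.aug) (E := LinearMap.pi fun _ => G.aug)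
      (fun t _ e he => by simpa using F.aug_homogeneous t e he)
      (fun t _ e he => by simpa using G.aug_homogeneous t e he) (by
        rintro _ ⟨v, rfl⟩
        obtain ⟨w, hw⟩ : G.aug v ∈ LinearMap.range F.aug := by
          have hG : G.aug v ∈ LinearMap.range G.aug := ⟨v, rfl⟩
          rwa [G.range_aug.trans F.range_aug.symm] at hG
        exact ⟨w, funext fun _ => hw⟩)
    exact ⟨φ, LinearMap.ext fun v => congrFun (LinearMap.congr_fun hc v) (), hφ⟩
  obtain ⟨φ₀, hc₀, hφ₀⟩ := h0
  have hseq := exists_dependent_seq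
    (α := fun i => (Fin (G.b i) → MvPolynomial (Fin n) K) →ₗ[MvPolynomial (Fin n) K]
      (Fin (F.b i) → MvPolynomial (Fin n) K))
    (P := fun i φ => (∀ h : i = 0, F.aug ∘ₗ (h ▸ φ) = G.aug) ∧
      (∀ j, IsHomogeneousVec (F.shift i) (G.shift i j) (φ (Pi.single j 1))) ∧
      LinearMap.range (φ ∘ₗ G.d i) ≤ LinearMap.range (F.d i))
    (r := fun i φ ψ => F.d i ∘ₗ ψ = φ ∘ₗ G.d i) ⟨φ₀, fun _ => hc₀, hφ₀, ?_⟩ ?_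
  · obtain ⟨φ, hP0, hP⟩ := hseq
    exact ⟨φ, hP0.1 rfl, fun i => (hP i).2, fun i => i.casesOn hP0.2.1 fun i => (hP i).1.2.1⟩
  · rintro _ ⟨v, rfl⟩
    rw [F.exact_zero, LinearMap.mem_ker]
    have hv : G.d 0 v ∈ LinearMap.ker G.aug := G.exact_zero ▸ ⟨v, rfl⟩
    exact (LinearMap.congr_fun hc₀ (G.d 0 v)).trans hv
  · rintro i φ ⟨-, hφ, hr⟩
    obtain ⟨ψ, hψ, hc⟩ := exists_homogeneous_lift (s := F.shift i) (sh := F.shift (i + 1))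
      (sh' := G.shift (i + 1)) (D := F.d i) (E := φ ∘ₗ G.d i)
      (fun t l e he => F.d_homogeneous i t l e he)
      (fun t => IsHomogeneousVec.map hφ fun l e he => G.d_homogeneous i t l e he) hr
    refine ⟨ψ, ⟨fun h => absurd h i.succ_ne_zero, hψ, ?_⟩, hc⟩
    rintro _ ⟨v, rfl⟩
    have hv : G.d (i + 1) v ∈ LinearMap.ker (G.d i) := G.exact_succ i ▸ ⟨v, rfl⟩
    rw [F.exact_succ, LinearMap.mem_ker]
    refine (LinearMap.congr_fun hc (G.d (i + 1) v)).trans ?_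
    rw [LinearMap.comp_apply, LinearMap.mem_ker.1 hv, map_zero]

theorem exists_lift_of_mem_range {R ι M N : Type*} [CommRing R] [Finite ι]
    [AddCommGroup M] [Module R M] [AddCommGroup N] [Module R N] {D : M →ₗ[R] N}
    {δ : (ι → R) →ₗ[R] N} (h : ∀ v, δ v ∈ LinearMap.range D) :
    ∃ h : (ι → R) →ₗ[R] M, D ∘ₗ h = δ := by
  obtain ⟨g, hg⟩ := Module.projective_lifting_property D.rangeRestrict (δ.codRestrict _ h)
    D.surjective_rangeRestrict
  exact ⟨g, LinearMap.ext fun v => congrArg Subtype.val (LinearMap.congr_fun hg v)⟩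

/-- A chain endomorphism of a minimal resolution that lifts the identity is the identity modulo
the ideal generated by the variables. -/
theorem constantCoeff_sub_eq_zero (F : MinimalMultigradedResolution I)
    (θ : ∀ i, (Fin (F.b i) → MvPolynomial (Fin n) K) →ₗ[MvPolynomial (Fin n) K]
        (Fin (F.b i) → MvPolynomial (Fin n) K))
    (h0 : F.aug ∘ₗ θ 0 = F.aug) (hθ : ∀ i, F.d i ∘ₗ θ (i + 1) = θ i ∘ₗ F.d i) (i : ℕ)
    (v : Fin (F.b i) → MvPolynomial (Fin n) K) (l : Fin (F.b i)) :
    constantCoeff ((θ i v - v) l) = 0 := by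
  have hdd : ∀ i v, F.d i (F.d (i + 1) v) = 0 := fun i v =>
    LinearMap.mem_ker.1 (F.exact_succ i ▸ ⟨v, rfl⟩)
  obtain ⟨k, hk⟩ : ∃ k, F.d 0 ∘ₗ k = θ 0 - LinearMap.id := by
    refine exists_lift_of_mem_range fun v => ?_
    rw [F.exact_zero, LinearMap.mem_ker, LinearMap.sub_apply, map_sub, LinearMap.id_apply]
    exact sub_eq_zero.2 (LinearMap.congr_fun h0 v)
  have hstep : ∀ i (k : (Fin (F.b i) → MvPolynomial (Fin n) K) →ₗ[MvPolynomial (Fin n) K]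
      (Fin (F.b (i + 1)) → MvPolynomial (Fin n) K)),
      (∀ v, F.d i (θ (i + 1) v - v - k (F.d i v)) = 0) →
      ∃ k', F.d (i + 1) ∘ₗ k' = θ (i + 1) - LinearMap.id - k ∘ₗ F.d i := by
    intro i k hk
    refine exists_lift_of_mem_range fun v => ?_
    rw [F.exact_succ]
    exact hk v
  have hhom : ∀ i, ∃ k : (Fin (F.b i) → MvPolynomial (Fin n) K) →ₗ[MvPolynomial (Fin n) K]
      (Fin (F.b (i + 1)) → MvPolynomial (Fin n) K),
      ∀ v, F.d i (θ (i + 1) v - v - k (F.d i v)) = 0 := by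
    intro i
    induction i with
    | zero =>
      refine ⟨k, fun v => ?_⟩
      have h₁ := LinearMap.congr_fun hk (F.d 0 v)
      have h₂ := LinearMap.congr_fun (hθ 0) v
      simp only [LinearMap.comp_apply, LinearMap.sub_apply, LinearMap.id_apply] at h₁ h₂
      rw [map_sub, map_sub, h₁, h₂, sub_self]
    | succ i ih =>
      obtain ⟨k, hk⟩ := ih
      obtain ⟨k', hk'⟩ := hstep i k hk
      refine ⟨k', fun v => ?_⟩
      have h₁ := LinearMap.congr_fun hk' (F.d (i + 1) v)
      have h₂ := LinearMap.congr_fun (hθ (i + 1)) v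
      simp only [LinearMap.comp_apply, LinearMap.sub_apply, LinearMap.id_apply, hdd,
        map_zero, sub_zero] at h₁ h₂
      rw [map_sub, map_sub, h₁, h₂, sub_self]
  cases i with
  | zero =>
    rw [show θ 0 v - v = F.d 0 (k v) from (LinearMap.congr_fun hk v).symm]
    exact constantCoeff_linearMap_apply _ _ _ fun t => Or.inr (F.minimal _ _ _)
  | succ i =>
    obtain ⟨k, hk⟩ := hhom i
    obtain ⟨k', hk'⟩ := hstep i k hk
    have h₁ : θ (i + 1) v - v = F.d (i + 1) (k' v) + k (F.d i v) := by
      have := LinearMap.congr_fun hk' v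
      simp only [LinearMap.comp_apply, LinearMap.sub_apply, LinearMap.id_apply] at this
      rw [this, sub_add_cancel]
    rw [h₁, Pi.add_apply, map_add,
      constantCoeff_linearMap_apply _ _ _ fun t => Or.inr (F.minimal _ _ _),
      constantCoeff_linearMap_apply k _ _ fun t => Or.inl
        (constantCoeff_linearMap_apply _ _ _ fun t => Or.inr (F.minimal _ _ _)), add_zero]

/-- All minimal multigraded resolutions have the same multigraded shifts. -/
theorem exists_shift_eq (F G : MinimalMultigradedResolution I) (i : ℕ) (j : Fin (G.b i)) :
    ∃ l, F.shift i l = G.shift i j := by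
  obtain ⟨φ, hφ0, hφ, hh⟩ := F.exists_comparison G
  obtain ⟨ψ, hψ0, hψ, -⟩ := G.exists_comparison F
  by_contra! hne
  have hz : ∀ l, constantCoeff (φ i (Pi.single j 1) l) = 0 := by
    intro l
    by_contra hc
    refine hne l ?_
    rw [← hh i j l 0 (mem_support_iff.2 hc), zero_add]
  have h₁ := G.constantCoeff_sub_eq_zero (fun i => ψ i ∘ₗ φ i)
    (by rw [← LinearMap.comp_assoc, hψ0, hφ0])
    (fun i => by rw [← LinearMap.comp_assoc, hψ, LinearMap.comp_assoc, hφ,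
      LinearMap.comp_assoc]) i (Pi.single j 1) j
  rw [Pi.sub_apply, map_sub, LinearMap.comp_apply,
    constantCoeff_linearMap_apply (ψ i) _ _ fun t => Or.inl (hz t)] at h₁
  simp at h₁

theorem HS_eq (F : MinimalMultigradedResolution I) (i : ℕ) :
    HS i I = monomialIdeal K (Set.range (F.shift i)) := by
  rw [HS]
  congr 1
  ext a
  constructor
  · rintro ⟨G, j, rfl⟩
    exact F.exists_shift_eq G i j
  · rintro ⟨j, rfl⟩
    exact ⟨F, j, rfl⟩

end MinimalMultigradedResolution

/-- The homogeneous elements `g_1, …, g_b` of a free module have quotients generated by variables: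
`(g_1, …, g_{j-1}) : g_j` is generated by the variables `x_i` with `i ∈ σ j`. -/
structure HasVariableQuotients {K : Type*} [Field K] {n b : ℕ} {κ : Type*}
    (s : κ → (Fin n →₀ ℕ)) (sh : Fin b → (Fin n →₀ ℕ)) (σ : Fin b → Finset (Fin n))
    (g : Fin b → κ → MvPolynomial (Fin n) K) : Prop where
  homogeneous : ∀ j, IsHomogeneousVec s (sh j) (g j)
  colon : ∀ j (p : MvPolynomial (Fin n) K),
    p • g j ∈ Submodule.span (MvPolynomial (Fin n) K) (g '' (Finset.Iio j : Finset (Fin b))) ↔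
      p ∈ Ideal.span (X '' (σ j : Set (Fin n)) : Set (MvPolynomial (Fin n) K))

theorem MvPolynomial.mem_span_X_of_mul_X_mem {R ι : Type*} [CommRing R] {A : Set ι}
    {i : ι} (hi : i ∉ A) {p : MvPolynomial ι R}
    (hp : p * X i ∈ Ideal.span (X '' A : Set (MvPolynomial ι R))) :
    p ∈ Ideal.span (X '' A : Set (MvPolynomial ι R)) := by
  classical
  rw [mem_ideal_span_X_image] at hp ⊢
  intro m hm
  obtain ⟨k, hk, hmk⟩ := hp (m + Finsupp.single i 1) (by
    rw [support_mul_X]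
    exact Finset.mem_map_of_mem (addRightEmbedding (Finsupp.single i 1)) hm)
  refine ⟨k, hk, ?_⟩
  have hik : i ≠ k := fun h => hi (h ▸ hk)
  simpa [Finsupp.single_apply, hik] using hmk

theorem Submodule.smul_mem_span_X {K : Type*} [Field K] {n : ℕ} {M : Type*} [AddCommGroup M]
    [Module (MvPolynomial (Fin n) K) M] {N : Submodule (MvPolynomial (Fin n) K) M} {v : M}
    {A : Set (Fin n)} (h : ∀ i ∈ A, (X i : MvPolynomial (Fin n) K) • v ∈ N)
    {p : MvPolynomial (Fin n) K}
    (hp : p ∈ Ideal.span (X '' A : Set (MvPolynomial (Fin n) K))) : p • v ∈ N := by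
  have : Ideal.span (X '' A : Set (MvPolynomial (Fin n) K)) ≤
      N.comap (LinearMap.toSpanSingleton _ _ v) := by
    rw [Ideal.span_le]
    rintro _ ⟨i, hi, rfl⟩
    exact h i hi
  exact this hp

namespace HasVariableQuotients

variable {K : Type*} [Field K] {n b : ℕ} {κ : Type*} {s : κ → (Fin n →₀ ℕ)}
  {sh : Fin b → (Fin n →₀ ℕ)} {σ : Fin b → Finset (Fin n)}
  {g : Fin b → κ → MvPolynomial (Fin n) K}

theorem exists_syzygy (h : HasVariableQuotients s sh σ g) (j : Fin b) {i : Fin n} (hi : i ∈ σ j) :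
    ∃ f : Fin b → MvPolynomial (Fin n) K, f j = X i ∧ (∀ t, j < t → f t = 0) ∧
      IsHomogeneousVec sh (sh j + Finsupp.single i 1) f ∧
      Fintype.linearCombination (MvPolynomial (Fin n) K) g f = 0 := by
  classical
  have hX := (h.colon j (X i)).2 (Ideal.subset_span ⟨i, hi, rfl⟩)
  obtain ⟨c, hcs, hc⟩ := Finsupp.mem_span_image_iff_linearCombination _ |>.1 hX
  rw [Finsupp.mem_supported'] at hcs
  rw [Finsupp.linearCombination_apply, Finsupp.sum_fintype _ _ (by simp)] at hc
  have hhom : IsHomogeneousVec s (sh j + Finsupp.single i 1)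
      ((X i : MvPolynomial (Fin n) K) • g j) := by
    intro l e he
    rw [Pi.smul_apply, smul_eq_mul, mul_comm, support_mul_X] at he
    obtain ⟨e', he', rfl⟩ := Finset.mem_map.1 he
    rw [addRightEmbedding_apply, ← h.homogeneous j l e' he']
    abel
  have hsum := IsHomogeneousVec.sum_homPart_smul h.homogeneous hhom
    hc
  refine ⟨Pi.single j (X i) - fun t => homPart (sh j + Finsupp.single i 1) (sh t) (c t),
    by simp [hcs j], fun t ht => by simp [ht.ne', hcs t (by simpa using ht.le)], ?_, ?_⟩
  · intro t e he
    rcases Finset.mem_union.1 (support_sub _ _ _ he) with he | he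
    · by_cases htj : t = j
      · subst htj
        rw [Pi.single_eq_same, support_X, Finset.mem_singleton] at he
        rw [he, add_comm]
      · simp [Pi.single_eq_of_ne htj] at he
    · exact add_eq_of_mem_support_homPart he
  · rw [map_sub, Fintype.linearCombination_apply_single, Fintype.linearCombination_apply, hsum,
      sub_self]

/-- Syzygies with leading terms `x_i e_j` (`i ∈ σ j`) generate all syzygies. -/
theorem mem_span_syzygies (h : HasVariableQuotients s sh σ g)
    {f : Fin b → Fin n → Fin b → MvPolynomial (Fin n) K}
    (hlead : ∀ j, ∀ i ∈ σ j, f j i j = X i) (hzero : ∀ j, ∀ i ∈ σ j, ∀ t, j < t → f j i t = 0)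
    (hker : ∀ j, ∀ i ∈ σ j, Fintype.linearCombination (MvPolynomial (Fin n) K) g (f j i) = 0)
    (N : ℕ) (v : Fin b → MvPolynomial (Fin n) K)
    (hv : Fintype.linearCombination (MvPolynomial (Fin n) K) g v = 0)
    (hN : ∀ t : Fin b, N ≤ t → v t = 0) :
    v ∈ Submodule.span (MvPolynomial (Fin n) K)
      {w | ∃ j : Fin b, (j : ℕ) < N ∧ ∃ i ∈ σ j, f j i = w} := by
  classical
  induction N generalizing v with
  | zero =>
    rw [show v = 0 from funext fun t => hN t (Nat.zero_le _)]
    exact Submodule.zero_mem _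
  | succ N ih =>
    have hmono : Submodule.span (MvPolynomial (Fin n) K)
        {w | ∃ j : Fin b, (j : ℕ) < N ∧ ∃ i ∈ σ j, f j i = w} ≤
        Submodule.span (MvPolynomial (Fin n) K)
        {w | ∃ j : Fin b, (j : ℕ) < N + 1 ∧ ∃ i ∈ σ j, f j i = w} :=
      Submodule.span_mono fun w ⟨j, hj, hw⟩ => ⟨j, by omega, hw⟩
    by_cases hb : N < b
    · have hmem : v ⟨N, hb⟩ • g ⟨N, hb⟩ ∈ Submodule.span (MvPolynomial (Fin n) K)
          (g '' (Finset.Iio (⟨N, hb⟩ : Fin b) : Finset (Fin b))) := by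
        rw [Fintype.linearCombination_apply,
          ← Finset.add_sum_erase _ _ (Finset.mem_univ ⟨N, hb⟩)] at hv
        rw [eq_neg_of_add_eq_zero_left hv]
        refine Submodule.neg_mem _ (Submodule.sum_mem _ fun t ht => ?_)
        have ht' : t ≠ ⟨N, hb⟩ := by simpa using ht
        by_cases hlt : t < ⟨N, hb⟩
        · exact Submodule.smul_mem _ _ (Submodule.subset_span ⟨t, by simpa using hlt, rfl⟩)
        · have : (N : ℕ) + 1 ≤ t := by
            rw [Fin.lt_def] at hlt
            have := Fin.val_ne_of_ne ht'
            simp only at hlt this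
            omega
          rw [hN t this, zero_smul]
          exact Submodule.zero_mem _
      have hle : Submodule.span (MvPolynomial (Fin n) K) (f ⟨N, hb⟩ '' (σ ⟨N, hb⟩)) ≤
          LinearMap.ker (Fintype.linearCombination (MvPolynomial (Fin n) K) g) := by
        rw [Submodule.span_le]
        rintro _ ⟨i, hi, rfl⟩
        exact hker _ i hi
      have hle' : ∀ t : Fin b, N < t →
          Submodule.span (MvPolynomial (Fin n) K) (f ⟨N, hb⟩ '' (σ ⟨N, hb⟩)) ≤
          LinearMap.ker (LinearMap.proj t) := by
        intro t ht
        rw [Submodule.span_le]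
        rintro _ ⟨i, hi, rfl⟩
        exact hzero _ i hi t (Fin.lt_def.2 ht)
      have himg : (X '' (σ ⟨N, hb⟩ : Set (Fin n)) : Set (MvPolynomial (Fin n) K)) =
          LinearMap.proj (R := MvPolynomial (Fin n) K) (φ := fun _ => MvPolynomial (Fin n) K)
            (⟨N, hb⟩ : Fin b) '' (f ⟨N, hb⟩ '' (σ ⟨N, hb⟩)) := by
        rw [Set.image_image]
        exact Set.image_congr fun i hi => (hlead _ i hi).symm
      rw [h.colon, himg, Ideal.span, Submodule.span_image] at hmem
      obtain ⟨z, hz, hzv⟩ := hmem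
      rw [← sub_add_cancel v z]
      refine Submodule.add_mem _ (hmono (ih (v - z) ?_ fun t ht => ?_)) (Submodule.span_mono ?_ hz)
      · rw [map_sub, hv, LinearMap.mem_ker.1 (hle hz), sub_zero]
      · rcases ht.eq_or_lt with ht | ht
        · obtain rfl : t = ⟨N, hb⟩ := Fin.ext ht.symm
          exact sub_eq_zero.2 hzv.symm
        · rw [Pi.sub_apply, hN t ht, show z t = 0 from hle' t ht hz, sub_zero]
      · rintro _ ⟨i, hi, rfl⟩
        exact ⟨⟨N, hb⟩, Nat.lt_succ_self N, i, hi, rfl⟩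
    · refine hmono (ih v hv fun t ht => absurd t.2 (by omega))

/-- The syzygies of elements with quotients generated by variables are generated by elements with
quotients generated by variables. -/
theorem exists_next (h : HasVariableQuotients s sh σ g) :
    ∃ (b' : ℕ) (sh' : Fin b' → (Fin n →₀ ℕ)) (σ' : Fin b' → Finset (Fin n))
      (g' : Fin b' → Fin b → MvPolynomial (Fin n) K), HasVariableQuotients sh sh' σ' g' ∧
      Submodule.span (MvPolynomial (Fin n) K) (Set.range g') =
        LinearMap.ker (Fintype.linearCombination (MvPolynomial (Fin n) K) g) ∧
      ∀ a τ, (∃ j, sh' j = a ∧ σ' j = τ) ↔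
        ∃ j, ∃ i ∈ σ j, sh j + Finsupp.single i 1 = a ∧ (σ j).filter (· < i) = τ := by
  classical
  choose! f hlead hzero hhom hker using
    fun j i => h.exists_syzygy j (i := i)
  let T : Finset (Fin b ×ₗ Fin n) :=
    Finset.univ.filter fun x => (ofLex x).2 ∈ σ (ofLex x).1
  let o := T.orderIsoOfFin rfl
  have hT : ∀ k, (ofLex (o k).1).2 ∈ σ (ofLex (o k).1).1 := fun k =>
    (Finset.mem_filter.1 (o k).2).2
  have hT' : ∀ j, ∀ i ∈ σ j, ∃ k, (o k).1 = toLex (j, i) := fun j i hi =>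
    ⟨o.symm ⟨toLex (j, i), by simp [T, hi]⟩, by simp⟩
  refine ⟨T.card, fun k => sh (ofLex (o k).1).1 + Finsupp.single (ofLex (o k).1).2 1,
    fun k => (σ (ofLex (o k).1).1).filter (· < (ofLex (o k).1).2),
    fun k => f (ofLex (o k).1).1 (ofLex (o k).1).2,
    ⟨fun k => hhom _ _ (hT k), fun k p => ⟨fun hp => ?_, fun hp => ?_⟩⟩, le_antisymm ?_ ?_, ?_⟩
  · refine mem_span_X_of_mul_X_mem (i := (ofLex (o k).1).2) (by simp) ?_
    rw [← hlead _ _ (hT k), ← smul_eq_mul, ← Pi.smul_apply]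
    refine (Submodule.span_le (p := Submodule.comap (LinearMap.proj (ofLex (o k).1).1)
      (Ideal.span (X '' (((σ (ofLex (o k).1).1).filter (· < (ofLex (o k).1).2) :
        Finset (Fin n)) : Set (Fin n)) : Set (MvPolynomial (Fin n) K))))).2 ?_ hp
    rintro _ ⟨k', hk', rfl⟩
    have hlt : (o k').1 < (o k).1 := o.strictMono (by simpa using hk')
    rw [SetLike.mem_coe, Submodule.mem_comap, LinearMap.proj_apply]
    rcases Prod.Lex.lt_iff.1 hlt with hlt | ⟨heq, hlt⟩
    · beta_reduce
      rw [hzero _ _ (hT k') _ hlt]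
      exact Submodule.zero_mem _
    · have hmem := hT k'
      have hl := hlead _ _ (hT k')
      rw [heq] at hmem hl
      beta_reduce
      rw [heq, hl]
      exact Ideal.subset_span ⟨_, by simpa using ⟨hmem, hlt⟩, rfl⟩
  · refine Submodule.smul_mem_span_X (fun i hiσ => ?_) hp
    obtain ⟨hi, hlt⟩ := Finset.mem_filter.1 (Finset.mem_coe.1 hiσ)
    clear hiσ hp
    generalize hj : (ofLex (o k).1).1 = j at *
    generalize hi' : (ofLex (o k).1).2 = i' at *
    have hk : i' ∈ σ j := by rw [← hi', ← hj]; exact hT k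
    have hok : (o k).1 = toLex (j, i') := by rw [← hi', ← hj]; rfl
    have hmem := h.mem_span_syzygies hlead hzero hker j
      ((X i : MvPolynomial (Fin n) K) • f j i' - (X i' : MvPolynomial (Fin n) K) • f j i)
      (by rw [map_sub, map_smul, map_smul, hker _ _ hk, hker _ _ hi, smul_zero, smul_zero, sub_zero])
      (fun t ht => by
        rcases (Fin.le_def.2 ht).eq_or_lt with rfl | ht
        · simp [hlead _ _ hk, hlead _ _ hi, mul_comm]
        · simp [hzero _ _ hk t ht, hzero _ _ hi t ht])
    rw [← sub_add_cancel ((X i : MvPolynomial (Fin n) K) • f j i')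
      ((X i' : MvPolynomial (Fin n) K) • f j i)]
    refine Submodule.add_mem _ (Submodule.span_mono ?_ hmem)
      (Submodule.smul_mem _ _ (Submodule.subset_span ?_))
    · rintro _ ⟨j₁, hj₁, i₁, hi₁, rfl⟩
      obtain ⟨k₁, hk₁⟩ := hT' j₁ i₁ hi₁
      refine ⟨k₁, ?_, by simp [hk₁]⟩
      rw [Finset.coe_Iio, Set.mem_Iio, ← o.lt_iff_lt, ← Subtype.coe_lt_coe, hk₁, hok,
        Prod.Lex.toLex_lt_toLex]
      exact Or.inl hj₁
    · obtain ⟨k₁, hk₁⟩ := hT' j i hi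
      refine ⟨k₁, ?_, by simp [hk₁]⟩
      rw [Finset.coe_Iio, Set.mem_Iio, ← o.lt_iff_lt, ← Subtype.coe_lt_coe, hk₁, hok,
        Prod.Lex.toLex_lt_toLex]
      exact Or.inr ⟨rfl, hlt⟩
  · rw [Submodule.span_le]
    rintro _ ⟨k, rfl⟩
    exact hker _ _ (hT k)
  · intro v hv
    refine Submodule.span_mono ?_ (h.mem_span_syzygies hlead hzero hker b v hv
      fun t ht => absurd t.2 (by omega))
    rintro _ ⟨j, -, i, hi, rfl⟩
    obtain ⟨k, hk⟩ := hT' j i hi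
    exact ⟨k, by simp [hk]⟩
  · intro a τ
    constructor
    · rintro ⟨k, h₁, h₂⟩
      exact ⟨_, _, hT k, h₁, h₂⟩
    · rintro ⟨j, i, hi, h₁, h₂⟩
      obtain ⟨k, hk⟩ := hT' j i hi
      exact ⟨k, by simp [hk, h₁], by simp [hk, h₂]⟩

end HasVariableQuotients

/-- Homogeneous elements of a free module with quotients generated by variables. -/
structure VariableQuotients (K : Type*) [Field K] (n : ℕ) where
  /-- the rank of the free module -/
  c : ℕ
  /-- the number of elements -/
  b : ℕ
  /-- the multidegrees of the basis of the free module -/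
  s : Fin c → (Fin n →₀ ℕ)
  /-- the multidegrees of the elements -/
  sh : Fin b → (Fin n →₀ ℕ)
  /-- the variables that generate the quotients -/
  σ : Fin b → Finset (Fin n)
  /-- the elements -/
  g : Fin b → Fin c → MvPolynomial (Fin n) K
  prop : HasVariableQuotients s sh σ g

namespace VariableQuotients

variable {K : Type*} [Field K] {n : ℕ}

/-- Generators of the syzygies, again with quotients generated by variables. -/
noncomputable def next (A : VariableQuotients K n) : VariableQuotients K n where
  c := A.b
  b := A.prop.exists_next.choose
  s := A.sh
  sh := A.prop.exists_next.choose_spec.choose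
  σ := A.prop.exists_next.choose_spec.choose_spec.choose
  g := A.prop.exists_next.choose_spec.choose_spec.choose_spec.choose
  prop := A.prop.exists_next.choose_spec.choose_spec.choose_spec.choose_spec.1

theorem span_next (A : VariableQuotients K n) :
    Submodule.span (MvPolynomial (Fin n) K) (Set.range A.next.g) =
      LinearMap.ker (Fintype.linearCombination (MvPolynomial (Fin n) K) A.g) :=
  A.prop.exists_next.choose_spec.choose_spec.choose_spec.choose_spec.2.1

theorem exists_next_iff (A : VariableQuotients K n) (a : Fin n →₀ ℕ) (τ : Finset (Fin n)) :
    (∃ j, A.next.sh j = a ∧ A.next.σ j = τ) ↔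
      ∃ j, ∃ i ∈ A.σ j, A.sh j + Finsupp.single i 1 = a ∧ (A.σ j).filter (· < i) = τ :=
  A.prop.exists_next.choose_spec.choose_spec.choose_spec.choose_spec.2.2 a τ

/-- The linear map with columns `A.next.g`. -/
noncomputable def diff (A : VariableQuotients K n) :
    (Fin A.next.b → MvPolynomial (Fin n) K) →ₗ[MvPolynomial (Fin n) K]
      (Fin A.b → MvPolynomial (Fin n) K) :=
  Fintype.linearCombination (MvPolynomial (Fin n) K)
    (show Fin A.next.b → Fin A.b → MvPolynomial (Fin n) K from A.next.g)

theorem diff_single (A : VariableQuotients K n) (j : Fin A.next.b) :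
    A.diff (Pi.single j 1) = A.next.g j :=
  (Fintype.linearCombination_apply_single (MvPolynomial (Fin n) K)
    (show Fin A.next.b → Fin A.b → MvPolynomial (Fin n) K from A.next.g) j 1).trans (one_smul _ _)

theorem isHomogeneousVec_diff_single (A : VariableQuotients K n) (j : Fin A.next.b) :
    IsHomogeneousVec A.sh (A.next.sh j) (A.diff (Pi.single j 1)) :=
  A.diff_single j ▸ A.next.prop.homogeneous j

theorem range_diff (A : VariableQuotients K n) :
    LinearMap.range A.diff =
      LinearMap.ker (Fintype.linearCombination (MvPolynomial (Fin n) K) A.g) :=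
  (Fintype.range_linearCombination (MvPolynomial (Fin n) K)
    (show Fin A.next.b → Fin A.b → MvPolynomial (Fin n) K from A.next.g)).trans A.span_next

/-- Iterated syzygies. -/
noncomputable def iter (A : VariableQuotients K n) : ℕ → VariableQuotients K n
  | 0 => A
  | i + 1 => (A.iter i).next

theorem exists_iter_iff (A : VariableQuotients K n) (k : ℕ) (a : Fin n →₀ ℕ)
    (τ : Finset (Fin n)) :
    (∃ j, (A.iter k).sh j = a ∧ (A.iter k).σ j = τ) ↔
      ∃ j, ∃ P ⊆ A.σ j, P.card = k ∧ A.sh j + ∑ p ∈ P, Finsupp.single p 1 = a ∧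
        (A.σ j).filter (fun i => ∀ p ∈ P, i < p) = τ := by
  classical
  induction k generalizing a τ with
  | zero => simp [iter]
  | succ k ih =>
    rw [iter, exists_next_iff]
    constructor
    · rintro ⟨j, i, hi, rfl, rfl⟩
      obtain ⟨j', P, hP, hk, ha, hτ⟩ := (ih _ _).1 ⟨j, rfl, rfl⟩
      rw [← hτ, Finset.mem_filter] at hi
      have hiP : i ∉ P := fun h => lt_irrefl _ (hi.2 i h)
      refine ⟨j', insert i P, Finset.insert_subset hi.1 hP, ?_, ?_, ?_⟩
      · rw [Finset.card_insert_of_notMem hiP, hk]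
      · rw [Finset.sum_insert hiP, ← ha]
        abel
      · rw [← hτ, Finset.filter_filter]
        refine Finset.filter_congr fun x _ => ?_
        rw [Finset.forall_mem_insert, and_comm]
    · rintro ⟨j, P, hP, hk, rfl, rfl⟩
      have hne : P.Nonempty := Finset.card_pos.1 (by omega)
      have hmin := P.min'_mem hne
      obtain ⟨j', h₁, h₂⟩ := (ih (A.sh j + ∑ p ∈ P.erase (P.min' hne), Finsupp.single p 1)
        ((A.σ j).filter fun i => ∀ p ∈ P.erase (P.min' hne), i < p)).2
        ⟨j, P.erase (P.min' hne), (Finset.erase_subset _ _).trans hP,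
          by rw [Finset.card_erase_of_mem hmin, hk, Nat.add_sub_cancel], rfl, rfl⟩
      refine ⟨j', P.min' hne, ?_, ?_, ?_⟩
      · rw [h₂, Finset.mem_filter]
        exact ⟨hP hmin, fun p hp => P.min'_lt_of_mem_erase_min' hne hp⟩
      · rw [h₁, ← Finset.sum_erase_add _ _ hmin, add_assoc]
      · rw [h₂, Finset.filter_filter]
        refine Finset.filter_congr fun x _ => ⟨fun h p hp => h.2.trans_le (P.min'_le p hp),
          fun h => ⟨fun p hp => h p (Finset.mem_of_mem_erase hp), h _ hmin⟩⟩

theorem degree_iter {A : VariableQuotients K n} {D : ℕ} (hA : ∀ j, (A.sh j).degree = D) (k : ℕ)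
    (j : Fin (A.iter k).b) : ((A.iter k).sh j).degree = D + k := by
  obtain ⟨j', P, -, hk, ha, -⟩ := (A.exists_iter_iff k _ _).1 ⟨j, rfl, rfl⟩
  rw [← ha, map_add, hA, map_sum]
  simp [Finsupp.degree_single, hk]

/-- The linear resolution given by iterated syzygies. -/
noncomputable def resolution {b : ℕ} {sh : Fin b → (Fin n →₀ ℕ)} {σ : Fin b → Finset (Fin n)}
    {g : Fin b → Fin 1 → MvPolynomial (Fin n) K}
    (h : HasVariableQuotients (fun _ : Fin 1 => 0) sh σ g) {D : ℕ}
    (hD : ∀ j, (sh j).degree = D) {I : Ideal (MvPolynomial (Fin n) K)}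
    (hI : Ideal.span (Set.range fun j => g j 0) = I) : MinimalMultigradedResolution I where
  b i := (iter ⟨1, b, _, sh, σ, g, h⟩ i).b
  shift i := (iter ⟨1, b, _, sh, σ, g, h⟩ i).sh
  d i := (iter ⟨1, b, _, sh, σ, g, h⟩ i).diff
  aug := Fintype.linearCombination (MvPolynomial (Fin n) K) fun j => g j 0
  aug_homogeneous j c hc := by
    rw [Fintype.linearCombination_apply_single, one_smul] at hc
    exact (add_zero c).symm.trans (h.homogeneous j 0 c hc)
  d_homogeneous i j l c hc :=
    (iter ⟨1, b, _, sh, σ, g, h⟩ i).isHomogeneousVec_diff_single j l c hc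
  range_aug := (Fintype.range_linearCombination (MvPolynomial (Fin n) K) fun j => g j 0).trans hI
  exact_zero := by
    refine (range_diff _).trans ?_
    have hv : ∀ v : Fin b → MvPolynomial (Fin n) K,
        Fintype.linearCombination (MvPolynomial (Fin n) K) g v = 0 ↔
        Fintype.linearCombination (MvPolynomial (Fin n) K) (fun j => g j 0) v = 0 := by
      intro v
      rw [Fintype.linearCombination_apply, Fintype.linearCombination_apply, funext_iff]
      simp
    exact Submodule.ext hv
  exact_succ i := range_diff (iter ⟨1, b, _, sh, σ, g, h⟩ (i + 1))
  minimal i j l := by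
    by_contra hc
    have h₁ := (iter ⟨1, b, _, sh, σ, g, h⟩ i).isHomogeneousVec_diff_single j l 0
      (mem_support_iff.2 hc)
    have h₂ := degree_iter (A := ⟨1, b, _, sh, σ, g, h⟩) hD (i + 1) j
    have h₃ := degree_iter (A := ⟨1, b, _, sh, σ, g, h⟩) hD i l
    rw [zero_add] at h₁
    have h₄ : D + i = D + (i + 1) := h₃.symm.trans ((congrArg Finsupp.degree h₁).trans h₂)
    omega

end VariableQuotients

/-- The homological shift ideals of an ideal generated by homogeneous elements of the same degree
with quotients generated by variables. -/
theorem HasVariableQuotients.HS_eq {K : Type*} [Field K] {n b : ℕ} {sh : Fin b → (Fin n →₀ ℕ)}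
    {σ : Fin b → Finset (Fin n)} {g : Fin b → Fin 1 → MvPolynomial (Fin n) K}
    (h : HasVariableQuotients (fun _ : Fin 1 => 0) sh σ g) {D : ℕ}
    (hD : ∀ j, (sh j).degree = D) {I : Ideal (MvPolynomial (Fin n) K)}
    (hI : Ideal.span (Set.range fun j => g j 0) = I) (k : ℕ) :
    HS k I = monomialIdeal K {a | ∃ j, ∃ P ⊆ σ j, P.card = k ∧
      sh j + ∑ p ∈ P, Finsupp.single p 1 = a} := by
  rw [(VariableQuotients.resolution h hD hI).HS_eq]
  congr 1
  ext a
  have := VariableQuotients.exists_iter_iff ⟨1, b, _, sh, σ, g, h⟩ k a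
  constructor
  · rintro ⟨j, hj⟩
    obtain ⟨j, P, hP, hk, ha, -⟩ := (this _).1 ⟨j, hj, rfl⟩
    exact ⟨j, P, hP, hk, ha⟩
  · rintro ⟨j, P, hP, hk, ha⟩
    obtain ⟨j, hj, -⟩ := (this _).2 ⟨j, P, hP, hk, ha, rfl⟩
    exact ⟨j, hj⟩

section Domination

variable {n : ℕ}

/-- `W` has at least as many elements as `V` in each initial segment. -/
def Dominates (V W : Finset (Fin n)) : Prop :=
  ∀ i : ℕ, (V.filter (fun x : Fin n => (x : ℕ) < i)).card ≤ (W.filter (fun x : Fin n => (x : ℕ) < i)).card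

theorem Dominates.trans {V W Z : Finset (Fin n)} (h₁ : Dominates V W) (h₂ : Dominates W Z) :
    Dominates V Z :=
  fun i => (h₁ i).trans (h₂ i)

theorem Dominates.of_subset {V W : Finset (Fin n)} (h : V ⊆ W) : Dominates V W :=
  fun _ => Finset.card_le_card (Finset.filter_subset_filter _ h)

theorem dominates_exchange {V : Finset (Fin n)} {i j : Fin n} (hi : i ∉ V)
    (hij : i < j) : Dominates V (insert i (V.erase j)) := by
  intro l
  have hi' : i ∉ (V.erase j).filter (fun x : Fin n => (x : ℕ) < l) := by simp [hi]
  rw [Finset.filter_insert, Finset.filter_erase] at *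
  split_ifs with hil
  · rw [Finset.card_insert_of_notMem hi']
    have := Finset.pred_card_le_card_erase (s := V.filter (fun x : Fin n => (x : ℕ) < l)) (a := j)
    omega
  · rw [Finset.erase_eq_of_notMem]
    simp only [Finset.mem_filter, not_and]
    rw [Fin.lt_def] at hij
    omega

/-- If `W` dominates `V`, exchanges `A ↦ A ∪ {i} \ {j}` with `i < j` lead from `V` to a subset
of `W`. -/
theorem Dominates.exists_subset {p : Finset (Fin n) → Prop}
    (hp : ∀ A, p A → ∀ j ∈ A, ∀ i, i ∉ A → i < j → p (insert i (A.erase j)))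
    {V W : Finset (Fin n)} (h : Dominates V W) (hV : p V) :
    ∃ V' ⊆ W, V'.card = V.card ∧ p V' := by
  induction hm : (V \ W).card generalizing V with
  | zero =>
    exact ⟨V, Finset.sdiff_eq_empty_iff_subset.1 (Finset.card_eq_zero.1 hm), rfl, hV⟩
  | succ m ih =>
    have hne : (V \ W).Nonempty := Finset.card_pos.1 (by omega)
    set j := (V \ W).min' hne with hj
    obtain ⟨hjV, hjW⟩ := Finset.mem_sdiff.1 ((V \ W).min'_mem hne)
    rw [← hj] at hjV hjW
    have hlow : ∀ l : ℕ, l ≤ j → V.filter (fun x : Fin n => (x : ℕ) < l) ⊆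
        W.filter (fun x : Fin n => (x : ℕ) < l) := by
      intro l hl x hx
      rw [Finset.mem_filter] at hx ⊢
      refine ⟨?_, hx.2⟩
      by_contra hxW
      have := (V \ W).min'_le x (Finset.mem_sdiff.2 ⟨hx.1, hxW⟩)
      rw [← hj, Fin.le_def] at this
      omega
    obtain ⟨i, hiW, hiV, hij⟩ : ∃ i ∈ W, i ∉ V ∧ i < j := by
      by_contra! hcon
      have hsub : W.filter (fun x : Fin n => (x : ℕ) < j + 1) ⊆
          (V.filter (fun x : Fin n => (x : ℕ) < j + 1)).erase j := by
        intro x hx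
        obtain ⟨hxW, hxj⟩ := Finset.mem_filter.1 hx
        have hxne : x ≠ j := fun h => hjW (h ▸ hxW)
        refine Finset.mem_erase.2 ⟨hxne, Finset.mem_filter.2 ⟨?_, hxj⟩⟩
        by_contra hxV
        exact absurd (hcon x hxW hxV) (not_le.2 (lt_of_le_of_ne (Fin.le_def.2 (by omega)) hxne))
      have h₁ := Finset.card_le_card hsub
      have hmem : j ∈ V.filter (fun x : Fin n => (x : ℕ) < j + 1) := by simp [hjV]
      rw [Finset.card_erase_of_mem hmem] at h₁
      have h₂ := h (j + 1)
      have h₃ := Finset.card_pos.2 ⟨j, hmem⟩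
      omega
    have hcard : (insert i (V.erase j)).card = V.card := by
      rw [Finset.card_insert_of_notMem (by simp [hiV]), Finset.card_erase_of_mem hjV]
      have := Finset.card_pos.2 ⟨j, hjV⟩
      omega
    have hdom : Dominates (insert i (V.erase j)) W := by
      intro l
      by_cases hl : l ≤ j
      · refine Finset.card_le_card fun x hx => ?_
        obtain ⟨hx, hxl⟩ := Finset.mem_filter.1 hx
        rcases Finset.mem_insert.1 hx with rfl | hx
        · exact Finset.mem_filter.2 ⟨hiW, hxl⟩
        · exact hlow l hl (Finset.mem_filter.2 ⟨Finset.mem_of_mem_erase hx, hxl⟩)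
      · refine le_trans ?_ (h l)
        have hil : (i : ℕ) < l := by rw [Fin.lt_def] at hij; omega
        have hmem : j ∈ V.filter (fun x : Fin n => (x : ℕ) < l) := by
          simp only [Finset.mem_filter]; exact ⟨hjV, by omega⟩
        rw [Finset.filter_insert, if_pos hil, Finset.filter_erase]
        refine (Finset.card_insert_le _ _).trans ?_
        rw [Finset.card_erase_of_mem hmem]
        have h₃ := Finset.card_pos.2 ⟨j, hmem⟩
        omega
    obtain ⟨V', h₁, h₂, h₃⟩ := ih hdom (hp V hV j hjV i hiV hij) (by
      have : insert i (V.erase j) \ W = (V \ W).erase j := by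
        rw [Finset.insert_sdiff_of_mem _ hiW, Finset.erase_sdiff_comm]
      rw [this, Finset.card_erase_of_mem (Finset.mem_sdiff.2 ⟨hjV, hjW⟩), hm]
      omega)
    exact ⟨V', h₁, h₂.trans hcard, h₃⟩

theorem Dominates.exists_dominated_subset {V W : Finset (Fin n)} (h : Dominates V W) :
    ∃ V' ⊆ W, V'.card = V.card ∧ Dominates V V' :=
  h.exists_subset (p := Dominates V)
    (fun _ hA _ _ _ hi hij => hA.trans (dominates_exchange hi hij)) (Dominates.of_subset le_rfl)

theorem Finset.exists_largest {α : Type*} [LinearOrder α] (S : Finset α) {k : ℕ}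
    (hk : k ≤ S.card) : ∃ Q ⊆ S, Q.card = k ∧ ∀ q ∈ S, q ∉ Q → ∀ p ∈ Q, q < p := by
  induction k with
  | zero => exact ⟨∅, by simp, by simp, by simp⟩
  | succ k ih =>
    obtain ⟨Q, hQ, hc, hl⟩ := ih (by omega)
    have hne : (S \ Q).Nonempty := by
      rw [← Finset.card_pos, Finset.card_sdiff_of_subset hQ]; omega
    have hmem := (S \ Q).max'_mem hne
    rw [Finset.mem_sdiff] at hmem
    refine ⟨insert ((S \ Q).max' hne) Q, Finset.insert_subset hmem.1 hQ, ?_, ?_⟩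
    · rw [Finset.card_insert_of_notMem hmem.2, hc]
    · intro q hq hqQ p hp
      rw [Finset.mem_insert, not_or] at hqQ
      rcases Finset.mem_insert.1 hp with rfl | hp
      · exact lt_of_le_of_ne (Finset.le_max' _ _ (Finset.mem_sdiff.2 ⟨hq, hqQ.2⟩)) hqQ.1
      · exact hl q hq hqQ.2 p hp

/-- The indices `i ∉ A` that are smaller than some element of `A`. -/
def gapFinset (A : Finset (Fin n)) : Finset (Fin n) :=
  Finset.univ.filter fun i => i ∉ A ∧ ∃ j ∈ A, i < j

theorem mem_gapFinset {A : Finset (Fin n)} {i : Fin n} :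
    i ∈ gapFinset A ↔ i ∉ A ∧ ∃ j ∈ A, i < j := by
  simp [gapFinset]

theorem disjoint_gapFinset (A : Finset (Fin n)) : Disjoint A (gapFinset A) :=
  Finset.disjoint_left.2 fun _ h h' => (mem_gapFinset.1 h').1 h

theorem exists_le_of_mem_union_gaps {A P : Finset (Fin n)} (hP : P ⊆ gapFinset A) {x : Fin n}
    (hx : x ∈ A ∪ P) : ∃ j ∈ A, x ≤ j := by
  rcases Finset.mem_union.1 hx with hx | hx
  · exact ⟨x, hx, le_rfl⟩
  · obtain ⟨-, j, hj, hxj⟩ := mem_gapFinset.1 (hP hx)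
    exact ⟨j, hj, hxj.le⟩

theorem card_union_gaps {A P : Finset (Fin n)} (hP : P ⊆ gapFinset A) :
    (A ∪ P).card = A.card + P.card :=
  Finset.card_union_of_disjoint ((disjoint_gapFinset A).mono_right hP)

theorem Dominates.exists_ge {V A : Finset (Fin n)} (h : Dominates V A) (hc : V.card = A.card)
    {j : Fin n} (hj : j ∈ A) : ∃ l ∈ V, j ≤ l := by
  by_contra! hlt
  have h₁ := h j
  rw [Finset.filter_true_of_mem fun x hx => Fin.lt_def.1 (hlt x hx), hc] at h₁
  exact absurd h₁ (not_le.2 (Finset.card_lt_card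
    (Finset.filter_ssubset.2 ⟨j, hj, lt_irrefl _⟩)))

theorem mem_or_mem_gapFinset {V : Finset (Fin n)} {x : Fin n} (h : ∃ j ∈ V, x ≤ j) :
    x ∈ V ∨ x ∈ gapFinset V := by
  obtain ⟨j, hj, hxj⟩ := h
  by_cases hx : x ∈ V
  · exact Or.inl hx
  · exact Or.inr (mem_gapFinset.2 ⟨hx, j, hj, lt_of_le_of_ne hxj fun h => hx (h ▸ hj)⟩)

theorem Finset.card_filter_lt_add_card_filter_not (W : Finset (Fin n)) (i : ℕ) :
    (W.filter (fun x : Fin n => (x : ℕ) < i)).card + (W.filter (fun x : Fin n => ¬ (x : ℕ) < i)).card = W.card :=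
  Finset.card_filter_add_card_filter_not _

theorem Dominates.exists_largest_gaps {V A P : Finset (Fin n)} (h : Dominates V A)
    (hc : V.card = A.card) (hP : P ⊆ gapFinset A) :
    ∃ Q ⊆ gapFinset V, Q.card = P.card ∧ (∀ q ∈ gapFinset V, q ∉ Q → ∀ p ∈ Q, q < p) ∧
      Dominates (V ∪ Q) (A ∪ P) := by
  have hmem : ∀ x ∈ A ∪ P, x ∈ V ∨ x ∈ gapFinset V := by
    intro x hx
    obtain ⟨j, hj, hxj⟩ := exists_le_of_mem_union_gaps hP hx
    obtain ⟨l, hl, hjl⟩ := h.exists_ge hc hj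
    exact mem_or_mem_gapFinset ⟨l, hl, hxj.trans hjl⟩
  have hcard : P.card ≤ (gapFinset V).card := by
    have h₁ := Finset.card_le_card (s := A ∪ P) (t := V ∪ gapFinset V)
      fun x hx => Finset.mem_union.2 (hmem x hx)
    rw [card_union_gaps hP, card_union_gaps le_rfl] at h₁
    omega
  obtain ⟨Q, hQ, hQc, hl⟩ := (gapFinset V).exists_largest hcard
  refine ⟨Q, hQ, hQc, hl, fun i => ?_⟩
  by_cases hi : ∃ p ∈ Q, (p : ℕ) < i
  · obtain ⟨p, hp, hpi⟩ := hi
    have hsub : (A ∪ P).filter (fun x : Fin n => ¬ (x : ℕ) < i) ⊆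
        (V ∪ Q).filter (fun x : Fin n => ¬ (x : ℕ) < i) := by
      intro x hx
      obtain ⟨hx, hxi⟩ := Finset.mem_filter.1 hx
      refine Finset.mem_filter.2 ⟨Finset.mem_union.2 ((hmem x hx).imp_right fun hg => ?_), hxi⟩
      by_contra hxQ
      have := Fin.lt_def.1 (hl x hg hxQ p hp)
      omega
    have h₁ := Finset.card_le_card hsub
    have h₂ := Finset.card_filter_lt_add_card_filter_not (A ∪ P) i
    have h₃ := Finset.card_filter_lt_add_card_filter_not (V ∪ Q) i
    rw [card_union_gaps hP] at h₂
    rw [card_union_gaps hQ] at h₃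
    omega
  · push Not at hi
    rw [Finset.filter_union, Finset.filter_false_of_mem (s := Q) fun x hx => not_lt.2 (hi x hx),
      Finset.union_empty]
    exact (h i).trans (Finset.card_le_card
      (Finset.filter_subset_filter _ Finset.subset_union_left))

theorem Dominates.exists_union_gaps_subset {V Q W : Finset (Fin n)} (hQ : Q ⊆ gapFinset V)
    (hQ0 : Q.Nonempty) (h : Dominates (V ∪ Q) W) :
    ∃ A P : Finset (Fin n), A.card = V.card ∧ Dominates V A ∧ P ⊆ gapFinset A ∧
      P.card = Q.card ∧ A ∪ P ⊆ W := by
  obtain ⟨W', hW', hc, hdom⟩ := h.exists_dominated_subset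
  rw [card_union_gaps hQ] at hc
  obtain ⟨q, hq⟩ := hQ0
  obtain ⟨j, hj, -⟩ := exists_le_of_mem_union_gaps hQ (Finset.mem_union_right V hq)
  have hVpos := Finset.card_pos.2 ⟨j, hj⟩
  have hne : W'.Nonempty := Finset.card_pos.1 (by omega)
  set M := W'.max' hne with hM
  have hMW : M ∈ W' := W'.max'_mem hne
  obtain ⟨P, hP, hPc, hl⟩ := (W'.erase M).exists_largest (k := Q.card)
    (by rw [Finset.card_erase_of_mem hMW]; omega)
  have hPW : P ⊆ W' := hP.trans (Finset.erase_subset _ _)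
  have hMP : M ∉ P := fun hMP => (Finset.mem_erase.1 (hP hMP)).1 rfl
  have hAc : (W' \ P).card = V.card := by
    rw [Finset.card_sdiff_of_subset hPW]; omega
  refine ⟨W' \ P, P, hAc, fun i => ?_, fun x hx => ?_, hPc, ?_⟩
  · by_cases hiM : i ≤ M
    · by_cases hi : ∃ p ∈ P, (p : ℕ) < i
      · obtain ⟨p, hp, hpi⟩ := hi
        have h₁ : (W' \ P).filter (fun x : Fin n => ¬ (x : ℕ) < i) ⊆ {M} := by
          intro x hx
          obtain ⟨hx, hxi⟩ := Finset.mem_filter.1 hx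
          obtain ⟨hxW, hxP⟩ := Finset.mem_sdiff.1 hx
          rw [Finset.mem_singleton]
          by_contra hxM
          have := Fin.lt_def.1 (hl x (Finset.mem_erase.2 ⟨hxM, hxW⟩) hxP p hp)
          omega
        have h₂ : (V.filter (fun x : Fin n => ¬ (x : ℕ) < i)).Nonempty := by
          by_contra hemp
          rw [Finset.not_nonempty_iff_eq_empty, Finset.filter_eq_empty_iff] at hemp
          have h₃ := hdom i
          rw [Finset.filter_true_of_mem, card_union_gaps hQ, ← hc] at h₃
          · exact absurd h₃ (not_le.2 (Finset.card_lt_card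
              (Finset.filter_ssubset.2 ⟨M, hMW, by omega⟩)))
          · intro x hx
            obtain ⟨l, hl, hxl⟩ := exists_le_of_mem_union_gaps hQ hx
            have := not_not.1 (hemp hl)
            rw [Fin.le_def] at hxl
            omega
        have h₃ := Finset.card_le_card h₁
        have h₄ := Finset.card_pos.2 h₂
        have h₅ := Finset.card_filter_lt_add_card_filter_not (W' \ P) i
        have h₆ := Finset.card_filter_lt_add_card_filter_not V i
        rw [Finset.card_singleton] at h₃
        omega
      · push Not at hi
        refine ((Finset.card_le_card (Finset.filter_subset_filter _
          Finset.subset_union_left)).trans (hdom i)).trans (Finset.card_le_card fun x hx => ?_)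
        obtain ⟨hx, hxi⟩ := Finset.mem_filter.1 hx
        refine Finset.mem_filter.2 ⟨Finset.mem_sdiff.2 ⟨hx, fun hxP => ?_⟩, hxi⟩
        have := hi x hxP
        omega
    · rw [Finset.filter_true_of_mem (s := W' \ P), hAc]
      · exact Finset.card_filter_le _ _
      · intro x hx
        have := Fin.le_def.1 (W'.le_max' x (Finset.mem_sdiff.1 hx).1)
        rw [← hM] at this
        omega
  · refine mem_gapFinset.2 ⟨fun h => (Finset.mem_sdiff.1 h).2 hx, M,
      Finset.mem_sdiff.2 ⟨hMW, hMP⟩, lt_of_le_of_ne (W'.le_max' x (hPW hx)) ?_⟩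
    exact (Finset.mem_erase.1 (hP hx)).1
  · rw [Finset.sdiff_union_of_subset hPW]
    exact hW'

end Domination

section SquarefreeBorel

variable {n : ℕ}

/-- The exponent vector of the product of the variables `x_i`, `i ∈ A`. -/
noncomputable def varProd (A : Finset (Fin n)) : Fin n →₀ ℕ :=
  ∑ i ∈ A, Finsupp.single i 1

theorem varProd_apply (A : Finset (Fin n)) (i : Fin n) :
    varProd A i = if i ∈ A then 1 else 0 := by
  simp [varProd, Finsupp.finsetSum_apply, Finsupp.single_apply]

theorem support_varProd (A : Finset (Fin n)) : (varProd A).support = A := by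
  ext i
  simp [varProd_apply]

theorem isBoundedMonomial_varProd (A : Finset (Fin n)) : IsBoundedMonomial 1 (varProd A) := by
  intro i
  rw [varProd_apply]
  split_ifs <;> simp

theorem varProd_support {u : Fin n →₀ ℕ} (hu : IsBoundedMonomial 1 u) : varProd u.support = u := by
  ext i
  have := hu i
  rw [varProd_apply]
  split_ifs with h
  · rw [Finsupp.mem_support_iff] at h
    omega
  · exact (Finsupp.notMem_support_iff.1 h).symm

theorem degree_varProd (A : Finset (Fin n)) : (varProd A).degree = A.card := by
  simp [varProd, map_sum, Finsupp.degree_single]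

theorem varProd_le_iff {A : Finset (Fin n)} {w : Fin n →₀ ℕ} : varProd A ≤ w ↔ A ⊆ w.support := by
  constructor
  · intro h i hi
    have := h i
    rw [varProd_apply, if_pos hi] at this
    rw [Finsupp.mem_support_iff]
    omega
  · intro h i
    rw [varProd_apply]
    split_ifs with hi
    · exact Nat.one_le_iff_ne_zero.2 (Finsupp.mem_support_iff.1 (h hi))
    · exact Nat.zero_le _

theorem varProd_union {A B : Finset (Fin n)} (h : Disjoint A B) :
    varProd (A ∪ B) = varProd A + varProd B :=
  Finset.sum_union h

theorem varProd_insert {A : Finset (Fin n)} {i : Fin n} (h : i ∉ A) :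
    varProd (insert i A) = Finsupp.single i 1 + varProd A :=
  Finset.sum_insert h

theorem varProd_exchange {A : Finset (Fin n)} {i j : Fin n} (hj : j ∈ A) (hi : i ∉ A) :
    varProd (insert i (A.erase j)) =
      varProd A - Finsupp.single j 1 + Finsupp.single i 1 := by
  rw [varProd_insert fun h => hi (Finset.mem_of_mem_erase h), add_comm]
  congr 1
  refine eq_tsub_of_add_eq ?_
  rw [add_comm, ← varProd_insert (Finset.notMem_erase j A), Finset.insert_erase hj]

variable {K : Type*} [Field K]

theorem monomial_mem_of_le {J : Ideal (MvPolynomial (Fin n) K)} {v w : Fin n →₀ ℕ} (h : v ≤ w)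
    (hv : monomial v (1 : K) ∈ J) : monomial w (1 : K) ∈ J := by
  have : monomial w (1 : K) = monomial (w - v) 1 * monomial v 1 := by
    rw [monomial_mul, tsub_add_cancel_of_le h, one_mul]
  rw [this]
  exact J.mul_mem_left _ hv

theorem monomialIdeal_le_iff {A : Set (Fin n →₀ ℕ)} {J : Ideal (MvPolynomial (Fin n) K)} :
    monomialIdeal K A ≤ J ↔ ∀ a ∈ A, monomial a (1 : K) ∈ J := by
  rw [monomialIdeal, Ideal.span_le, Set.image_subset_iff]
  rfl

theorem isKBorel_dominating (U : Set (Fin n →₀ ℕ)) :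
    IsKBorel 1 (monomialIdeal K {w | ∃ u ∈ U, ∃ W, Dominates u.support W ∧ varProd W = w}) where
  bounded := ⟨_, by
    rintro _ ⟨u, -, W, -, rfl⟩
    exact isBoundedMonomial_varProd W, rfl⟩
  exchange v hv hvI j hj i hij hb := by
    rw [monomial_mem_monomialIdeal] at hvI ⊢
    obtain ⟨_, ⟨u, hu, W, hW, rfl⟩, hle⟩ := hvI
    have hi : i ∉ v.support := by
      intro hi
      have h₁ := hb i
      rw [Finsupp.mem_support_iff] at hi
      simp only [Finsupp.add_apply, Finsupp.tsub_apply, Finsupp.single_apply, hij.ne',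
        if_false, if_true] at h₁
      omega
    refine ⟨_, ⟨u, hu, insert i (v.support.erase j), ?_, rfl⟩, ?_⟩
    · exact (hW.trans (Dominates.of_subset (varProd_le_iff.1 hle))).trans
        (dominates_exchange hi hij)
    · rw [varProd_exchange hj hi, varProd_support hv]

theorem monomial_mem_borelIdeal_iff {U : Set (Fin n →₀ ℕ)} (hU : ∀ u ∈ U, IsBoundedMonomial 1 u)
    {w : Fin n →₀ ℕ} :
    monomial w (1 : K) ∈ borelIdeal K 1 U ↔ ∃ u ∈ U, Dominates u.support w.support := by
  constructor
  · intro h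
    have h₁ := (isLeast_borelIdeal K 1 U).2 ⟨isKBorel_dominating U, fun u hu =>
      monomial_mem_monomialIdeal.2
        ⟨_, ⟨u, hu, u.support, Dominates.of_subset le_rfl, rfl⟩, (varProd_support (hU u hu)).le⟩⟩ h
    obtain ⟨_, ⟨u, hu, W, hW, rfl⟩, hle⟩ := monomial_mem_monomialIdeal.1 h₁
    exact ⟨u, hu, hW.trans (Dominates.of_subset (varProd_le_iff.1 hle))⟩
  · rintro ⟨u, hu, hd⟩
    obtain ⟨hB, hmem⟩ := (isLeast_borelIdeal K 1 U).1
    obtain ⟨V, hV, -, hVI⟩ := hd.exists_subset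
      (p := fun A => monomial (varProd A) (1 : K) ∈ borelIdeal K 1 U)
      (fun A hA j hj i hi hij => by
        rw [varProd_exchange hj hi]
        refine hB.exchange _ (isBoundedMonomial_varProd A) hA j (by rwa [support_varProd]) i hij ?_
        rw [← varProd_exchange hj hi]
        exact isBoundedMonomial_varProd _)
      (by rw [varProd_support (hU u hu)]; exact hmem u hu)
    exact monomial_mem_of_le (varProd_le_iff.2 hV) hVI

theorem borelIdeal_eq_monomialIdeal {U : Set (Fin n →₀ ℕ)} (hU : ∀ u ∈ U, IsBoundedMonomial 1 u)
    {B : Set (Fin n →₀ ℕ)}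
    (hB : ∀ w : Fin n →₀ ℕ, (∃ u ∈ U, Dominates u.support w.support) ↔ ∃ b ∈ B, b ≤ w) :
    borelIdeal K 1 U = monomialIdeal K B := by
  refine le_antisymm ?_ ?_
  · obtain ⟨A, -, hA⟩ := (isLeast_borelIdeal K 1 U).1.1.bounded
    rw [hA, monomialIdeal_le_iff]
    intro a ha
    rw [monomial_mem_monomialIdeal, ← hB, ← monomial_mem_borelIdeal_iff (K := K) hU, hA,
      monomial_mem_monomialIdeal]
    exact ⟨a, ha, le_rfl⟩
  · rw [monomialIdeal_le_iff]
    intro b hb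
    rw [monomial_mem_borelIdeal_iff hU, hB]
    exact ⟨b, hb, le_rfl⟩

/-- A set of `d`-subsets that is closed under exchanges has, in the colexicographic order, quotients
generated by variables. -/
theorem hasVariableQuotients_of_exchange (K : Type*) [Field K] {d : ℕ}
    {G : Finset (Finset (Fin n))} (hcard : ∀ A ∈ G, A.card = d)
    (hG : ∀ A ∈ G, ∀ j ∈ A, ∀ i, i ∉ A → i < j → insert i (A.erase j) ∈ G) :
    ∃ (b : ℕ) (f : Fin b → Finset (Fin n)), Set.range f = G ∧
      HasVariableQuotients (fun _ : Fin 1 => 0) (fun j => varProd (f j))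
        (fun j => gapFinset (f j)) (fun j _ => monomial (varProd (f j)) (1 : K)) := by
  classical
  let T : Finset (Colex (Finset (Fin n))) := G.map toColex.toEmbedding
  let o := T.orderIsoOfFin rfl
  have hT : ∀ k, ofColex (o k).1 ∈ G := fun k => by
    obtain ⟨A, hA, hAk⟩ := Finset.mem_map.1 (o k).2
    rw [← hAk]
    exact hA
  have hT' : ∀ A ∈ G, ∃ k, (o k).1 = toColex A := fun A hA =>
    ⟨o.symm ⟨toColex A, Finset.mem_map.2 ⟨A, hA, rfl⟩⟩, by simp⟩
  refine ⟨T.card, fun k => ofColex (o k).1, ?_, ⟨fun j l e he => ?_, fun j p => ⟨fun hp => ?_,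
    fun hp => Submodule.smul_mem_span_X (fun i hi => ?_) hp⟩⟩⟩
  · ext A
    constructor
    · rintro ⟨k, rfl⟩
      exact hT k
    · intro hA
      obtain ⟨k, hk⟩ := hT' A hA
      exact ⟨k, by simp [hk]⟩
  · rw [add_zero]
    exact Finset.mem_singleton.1 (support_monomial_subset he)
  · have hle : p * monomial (varProd (ofColex (o j).1)) (1 : K) ∈ Ideal.span
        ((fun a => monomial a (1 : K)) '' {a | ∃ k < j, varProd (ofColex (o k).1) = a}) := by
      refine (Submodule.span_le (p := Submodule.comap (LinearMap.proj (0 : Fin 1)) (Ideal.span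
        ((fun a => monomial a (1 : K)) '' {a | ∃ k < j, varProd (ofColex (o k).1) = a})))).2 ?_ hp
      rintro _ ⟨k, hk, rfl⟩
      exact Ideal.subset_span ⟨_, ⟨k, by simpa using hk, rfl⟩, rfl⟩
    rw [mem_ideal_span_monomial_image] at hle
    rw [mem_ideal_span_X_image]
    intro e he
    obtain ⟨_, ⟨k, hk, rfl⟩, hke⟩ := hle (e + varProd (ofColex (o j).1)) (by
      rw [mem_support_iff, coeff_mul_monomial, mul_one]
      exact mem_support_iff.1 he)
    have hlt : (o k).1 < (o j).1 := o.strictMono hk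
    obtain ⟨hne, hlt⟩ := Finset.Colex.toColex_lt_toColex.1
      (show toColex (ofColex (o k).1) < toColex (ofColex (o j).1) from hlt)
    obtain ⟨a, hak, haj⟩ : ∃ a ∈ ofColex (o k).1, a ∉ ofColex (o j).1 := by
      by_contra! hsub
      exact hne (Finset.eq_of_subset_of_card_le hsub
        (by rw [hcard _ (hT k), hcard _ (hT j)]))
    obtain ⟨c, hcj, -, hac⟩ := hlt hak haj
    refine ⟨a, mem_gapFinset.2 ⟨haj, c, hcj, lt_of_le_of_ne hac fun h => haj (h ▸ hcj)⟩, ?_⟩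
    have := hke a
    rw [Finsupp.add_apply, varProd_apply, varProd_apply, if_pos hak, if_neg haj] at this
    omega
  · obtain ⟨hi, c, hc, hic⟩ := mem_gapFinset.1 (Finset.mem_coe.1 hi)
    obtain ⟨k, hk⟩ := hT' _ (hG _ (hT j) c hc i hi hic)
    have hlt : k < j := by
      rw [← o.lt_iff_lt, ← Subtype.coe_lt_coe, hk,
        show (o j).1 = toColex (ofColex (o j).1) from rfl, Finset.Colex.toColex_lt_toColex]
      refine ⟨fun h => hi (h.subset (Finset.mem_insert_self _ _)), fun a ha haj => ?_⟩
      rcases Finset.mem_insert.1 ha with rfl | ha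
      · exact ⟨c, hc, by simp [hic.ne'], hic.le⟩
      · exact absurd (Finset.mem_of_mem_erase ha) haj
    have heq : (X i : MvPolynomial (Fin n) K) •
        (fun _ : Fin 1 => monomial (varProd (ofColex (o j).1)) (1 : K)) =
        (X c : MvPolynomial (Fin n) K) •
          (fun _ : Fin 1 => monomial (varProd (ofColex (o k).1)) (1 : K)) := by
      funext _
      simp only [Pi.smul_apply, smul_eq_mul, X, monomial_mul, mul_one]
      congr 1
      rw [hk, ofColex_toColex, varProd_insert (fun h => hi (Finset.mem_of_mem_erase h)),
        add_left_comm, ← varProd_insert (Finset.notMem_erase _ _), Finset.insert_erase hc]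
    rw [heq]
    exact Submodule.smul_mem _ _ (Submodule.subset_span ⟨k, by simpa using hlt, rfl⟩)

theorem HS_borelIdeal {d k : ℕ} {U : Set (Fin n →₀ ℕ)} (hU : ∀ u ∈ U, IsBoundedMonomial 1 u)
    (hd : ∀ u ∈ U, u.degree = d) (hk : 1 ≤ k) :
    HS k (borelIdeal K 1 U) = borelIdeal K 1 {w | ∃ u ∈ U, ∃ P : Finset (Fin n),
      IsLargestGaps u k P ∧ w = varProd P + u} := by
  classical
  have hcardU : ∀ u ∈ U, u.support.card = d := fun u hu => by
    rw [← degree_varProd, varProd_support (hU u hu), hd u hu]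
  have hgaps : ∀ u : Fin n →₀ ℕ, gaps u = gapFinset u.support := fun u => by
    ext i; simp [gaps, gapFinset]
  have hsupp : ∀ u ∈ U, ∀ P ⊆ gapFinset u.support,
      varProd P + u = varProd (u.support ∪ P) := fun u hu P hP => by
    rw [varProd_union ((disjoint_gapFinset _).mono_right hP), varProd_support (hU u hu), add_comm]
  let G : Finset (Finset (Fin n)) := Finset.univ.filter fun A =>
    A.card = d ∧ ∃ u ∈ U, Dominates u.support A
  have hmemG : ∀ A, A ∈ G ↔ A.card = d ∧ ∃ u ∈ U, Dominates u.support A := by simp [G]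
  obtain ⟨b, f, hf, hq⟩ := hasVariableQuotients_of_exchange K (d := d) (G := G)
    (fun A hA => ((hmemG A).1 hA).1) (fun A hA j hj i hi hij => by
      obtain ⟨hc, u, hu, hdom⟩ := (hmemG A).1 hA
      refine (hmemG _).2 ⟨?_, u, hu, hdom.trans (dominates_exchange hi hij)⟩
      rw [Finset.card_insert_of_notMem fun h => hi (Finset.mem_of_mem_erase h),
        Finset.card_erase_add_one hj, hc])
  have hfG : ∀ j, f j ∈ G := fun j => by
    rw [← Finset.mem_coe, ← hf]; exact ⟨j, rfl⟩
  have hspan : Ideal.span (Set.range fun j => monomial (varProd (f j)) (1 : K)) =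
      borelIdeal K 1 U := by
    rw [borelIdeal_eq_monomialIdeal (B := Set.range fun j => varProd (f j)) hU, monomialIdeal,
      ← Set.range_comp]
    · rfl
    · intro w
      constructor
      · rintro ⟨u, hu, hdom⟩
        obtain ⟨V, hV, hc, hdV⟩ := hdom.exists_dominated_subset
        obtain ⟨j, rfl⟩ : V ∈ Set.range f := by
          rw [hf]
          exact (hmemG V).2 ⟨hc.trans (hcardU u hu), u, hu, hdV⟩
        exact ⟨_, ⟨j, rfl⟩, varProd_le_iff.2 hV⟩
      · rintro ⟨_, ⟨j, rfl⟩, hle⟩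
        obtain ⟨-, u, hu, hdom⟩ := (hmemG _).1 (hfG j)
        exact ⟨u, hu, hdom.trans (Dominates.of_subset (varProd_le_iff.1 hle))⟩
  rw [hq.HS_eq (D := d) (fun j => by rw [degree_varProd, ((hmemG _).1 (hfG j)).1]) hspan k]
  symm
  have hsub : ∀ {u : Fin n →₀ ℕ} {P : Finset (Fin n)}, IsLargestGaps u k P →
      P ⊆ gapFinset u.support := fun {u P} h p hp => by
    have := h.subset p hp
    rwa [hgaps] at this
  refine borelIdeal_eq_monomialIdeal ?_ fun w => ⟨?_, ?_⟩
  · rintro _ ⟨u, hu, P, hP, rfl⟩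
    rw [hsupp u hu P (hsub hP)]
    exact isBoundedMonomial_varProd _
  · rintro ⟨_, ⟨u, hu, Q, hQ, rfl⟩, hdom⟩
    rw [hsupp u hu Q (hsub hQ), support_varProd] at hdom
    obtain ⟨A, P, hA, hdA, hP, hPc, hle⟩ := hdom.exists_union_gaps_subset (hsub hQ)
      (Finset.card_pos.1 (by rw [hQ.card]; omega))
    obtain ⟨j, rfl⟩ : A ∈ Set.range f := by
      rw [hf]
      exact (hmemG A).2 ⟨hA.trans (hcardU u hu), u, hu, hdA⟩
    refine ⟨_, ⟨j, P, hP, hPc.trans hQ.card, rfl⟩, ?_⟩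
    change varProd (f j) + varProd P ≤ w
    rw [← varProd_union ((disjoint_gapFinset _).mono_right hP)]
    exact varProd_le_iff.2 hle
  · rintro ⟨_, ⟨j, P, hP, hPc, rfl⟩, hle⟩
    change varProd (f j) + varProd P ≤ w at hle
    rw [← varProd_union ((disjoint_gapFinset _).mono_right hP)] at hle
    obtain ⟨hc, u, hu, hdom⟩ := (hmemG _).1 (hfG j)
    obtain ⟨Q, hQ, hQc, hl, hdQ⟩ := hdom.exists_largest_gaps ((hcardU u hu).trans hc.symm) hP
    refine ⟨_, ⟨u, hu, Q, ⟨fun p hp => ?_, hQc.trans hPc, fun q hq => ?_⟩, rfl⟩, ?_⟩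
    · rw [hgaps]
      exact hQ hp
    · rw [hgaps] at hq
      exact hl q hq
    · rw [hsupp u hu Q hQ, support_varProd]
      exact hdQ.trans (Dominates.of_subset (varProd_le_iff.1 hle))

theorem isLargestGaps_one_iff {u : Fin n →₀ ℕ} {P : Finset (Fin n)} :
    IsLargestGaps u 1 P ↔ ∃ p, IsGreatest (gaps u) p ∧ P = {p} := by
  constructor
  · intro h
    obtain ⟨p, rfl⟩ := Finset.card_eq_one.1 h.card
    refine ⟨p, ⟨h.subset p (Finset.mem_singleton_self p), fun q hq => ?_⟩, rfl⟩
    by_cases hqp : q = p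
    · exact hqp.le
    · exact (h.largest q hq (by simpa using hqp) p (Finset.mem_singleton_self p)).le
  · rintro ⟨p, hp, rfl⟩
    refine ⟨by simpa using hp.1, by simp, fun q hq hqp r hr => ?_⟩
    rw [Finset.mem_singleton.1 hr]
    exact lt_of_le_of_ne (hp.2 hq) (by simpa using hqp)

theorem gaps_varProd_add {u : Fin n →₀ ℕ} {P : Finset (Fin n)} (hP : ∀ p ∈ P, p ∈ gaps u) :
    gaps (varProd P + u) = gaps u \ P := by
  classical
  have hs : (varProd P + u).support = P ∪ u.support := by
    ext i
    simp only [Finsupp.mem_support_iff, Finsupp.add_apply, varProd_apply, Finset.mem_union]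
    split_ifs with h <;> simp [h]
  ext i
  simp only [gaps, hs, Finset.mem_union, not_or, Set.mem_ofPred_eq, Set.mem_sdiff, Finset.mem_coe]
  constructor
  · rintro ⟨⟨hiP, hiu⟩, j, hj, hij⟩
    refine ⟨⟨hiu, ?_⟩, hiP⟩
    rcases hj with hj | hj
    · obtain ⟨-, l, hl, hjl⟩ := hP j hj
      exact ⟨l, hl, hij.trans hjl⟩
    · exact ⟨j, hj, hij⟩
  · rintro ⟨⟨hiu, j, hj, hij⟩, hiP⟩
    exact ⟨⟨hiP, hiu⟩, j, Or.inr hj, hij⟩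

theorem isLargestGaps_succ_iff {u : Fin n →₀ ℕ} {k : ℕ} {w : Fin n →₀ ℕ} :
    (∃ Q : Finset (Fin n), IsLargestGaps u (k + 1) Q ∧ w = varProd Q + u) ↔
      ∃ P : Finset (Fin n), IsLargestGaps u k P ∧ ∃ R : Finset (Fin n),
        IsLargestGaps (varProd P + u) 1 R ∧ w = varProd R + (varProd P + u) := by
  classical
  constructor
  · rintro ⟨Q, hQ, rfl⟩
    have hne : Q.Nonempty := Finset.card_pos.1 (by rw [hQ.card]; omega)
    have hmin := Q.min'_mem hne
    have hP : ∀ p ∈ Q.erase (Q.min' hne), p ∈ gaps u :=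
      fun p hp => hQ.subset p (Finset.mem_of_mem_erase hp)
    refine ⟨Q.erase (Q.min' hne), ⟨hP, ?_, fun q hq hqP p hp => ?_⟩, {Q.min' hne}, ?_, ?_⟩
    · rw [Finset.card_erase_of_mem hmin, hQ.card, Nat.add_sub_cancel]
    · by_cases hqQ : q ∈ Q
      · have : q = Q.min' hne := by
          by_contra hne'
          exact hqP (Finset.mem_erase.2 ⟨hne', hqQ⟩)
        rw [this]
        exact Q.min'_lt_of_mem_erase_min' hne hp
      · exact hQ.largest q hq hqQ p (Finset.mem_of_mem_erase hp)
    · refine isLargestGaps_one_iff.2 ⟨_, ?_, rfl⟩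
      rw [gaps_varProd_add hP]
      refine ⟨⟨hQ.subset _ hmin, by simp⟩, fun q hq => ?_⟩
      by_cases hqQ : q ∈ Q
      · have : q = Q.min' hne := by
          by_contra hne'
          exact hq.2 (Finset.mem_coe.2 (Finset.mem_erase.2 ⟨hne', hqQ⟩))
        exact this.le
      · exact (hQ.largest q hq.1 hqQ _ hmin).le
    · rw [← add_assoc, ← varProd_union (by simp), ← Finset.insert_eq, Finset.insert_erase hmin]
  · rintro ⟨P, hP, R, hR, rfl⟩
    obtain ⟨p, hp, rfl⟩ := isLargestGaps_one_iff.1 hR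
    rw [gaps_varProd_add hP.subset] at hp
    have hpP : p ∉ P := fun h => hp.1.2 (Finset.mem_coe.2 h)
    refine ⟨insert p P, ⟨?_, ?_, fun q hq hqP r hr => ?_⟩, ?_⟩
    · rw [Finset.forall_mem_insert]
      exact ⟨hp.1.1, hP.subset⟩
    · rw [Finset.card_insert_of_notMem hpP, hP.card]
    · rw [Finset.mem_insert, not_or] at hqP
      rcases Finset.mem_insert.1 hr with rfl | hr
      · exact lt_of_le_of_ne (hp.2 ⟨hq, fun h => hqP.2 (Finset.mem_coe.1 h)⟩) hqP.1
      · exact hP.largest q hq hqP.2 r hr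
    · rw [← add_assoc, ← varProd_union (by simpa using hpP), ← Finset.insert_eq]

end SquarefreeBorel

theorem proposition4p1 {K : Type*} [Field K] {n m d : ℕ} (u : Fin m → (Fin n →₀ ℕ))
    (hsq : ∀ t, IsBoundedMonomial 1 (u t)) (hdeg : ∀ t, (u t).degree = d)
    (I : Ideal (MvPolynomial (Fin n) K)) (hI : I = borelIdeal K 1 (Set.range u)) :
    HS 1 I = borelIdeal K 1
        {w | ∃ (t : Fin m) (p : Fin n), IsGreatest (gaps (u t)) p ∧
          w = Finsupp.single p 1 + u t} ∧
      ∀ k : ℕ, 1 ≤ k →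
        HS k I = borelIdeal K 1
            {w | ∃ (t : Fin m) (P : Finset (Fin n)), IsLargestGaps (u t) k P ∧
              w = (∑ p ∈ P, Finsupp.single p 1) + u t} ∧
          HS 1 (HS k I) = HS (k + 1) I := by
  subst hI
  have hU : ∀ w ∈ Set.range u, IsBoundedMonomial 1 w := by rintro _ ⟨t, rfl⟩; exact hsq t
  have hd : ∀ w ∈ Set.range u, w.degree = d := by rintro _ ⟨t, rfl⟩; exact hdeg t
  refine ⟨?_, fun k hk => ⟨?_, ?_⟩⟩
  · rw [HS_borelIdeal hU hd le_rfl]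
    congr 1
    ext w
    simp only [Set.exists_range_iff, Set.mem_ofPred_eq, isLargestGaps_one_iff]
    refine exists_congr fun t => ?_
    constructor
    · rintro ⟨_, ⟨p, hp, rfl⟩, rfl⟩
      exact ⟨p, hp, by simp [varProd]⟩
    · rintro ⟨p, hp, rfl⟩
      exact ⟨_, ⟨p, hp, rfl⟩, by simp [varProd]⟩
  · rw [HS_borelIdeal hU hd hk]
    simp only [Set.exists_range_iff, varProd]
  · rw [HS_borelIdeal hU hd hk, HS_borelIdeal hU hd (Nat.le_add_left 1 k),
      HS_borelIdeal (d := k + d) ?_ ?_ le_rfl]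
    · congr 1
      ext w
      constructor
      · rintro ⟨_, ⟨v, hv, P, hP, rfl⟩, R, hR, rfl⟩
        exact ⟨v, hv, isLargestGaps_succ_iff.2 ⟨P, hP, R, hR, rfl⟩⟩
      · rintro ⟨v, hv, hQ⟩
        obtain ⟨P, hP, R, hR, rfl⟩ := isLargestGaps_succ_iff.1 hQ
        exact ⟨_, ⟨v, hv, P, hP, rfl⟩, R, hR, rfl⟩
    · rintro _ ⟨v, hv, P, hP, rfl⟩ i
      rw [Finsupp.add_apply, varProd_apply]
      split_ifs with hi
      · rw [Finsupp.notMem_support_iff.1 (hP.subset i hi).1, add_zero]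
      · rw [zero_add]
        exact hU v hv i
    · rintro _ ⟨v, hv, P, hP, rfl⟩
      rw [map_add, degree_varProd, hP.card, hd v hv]
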